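/- Let $\mathbb N=\{1,2,3,\dots\}$ and $\mathbb T=[0,1]$. Call $w$ a weight satisfying (A) if $w$ is positive, increasing and bounded on $(0,1)$ and $\int_0^1\log w(t)\,dt=-\infty$. For $\Lambda\subset\mathbb R$ put $E(\Lambda)=\{e^{2\pi i\lambda t}:\lambda\in\Lambda\}$. There is an absolute constant $C>0$ such that the following holds. Suppose that $\Gamma\subset\mathbb N$ contains a subset $\Gamma_1$ with $$\sum_{\gamma\in\Gamma_1}\frac1{\sqrt\gamma}=\infty\qquad\text{and}\qquad \#\bigl(\Gamma_1\cap(0,x)\bigr)\le C\,\frac{\sqrt x}{\log x}\,(1+o(1)),\quad x\to\infty .$$ Then there is a weight $w$ satisfying (A) such that $E(\mathbb N\setminus\Gamma)$ is not complete in $L^2(\mathbb T,w)$, i.e. the closed linear span of $E(\mathbb N\setminus\Gamma)$ is a proper subspace of $L^2(\mathbb T,w)$. -/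

import Mathlib

open MeasureTheory Filter

noncomputable section

/-- The measure `w(t) dt` on the circle, identified with the unit interval. -/
def weightedMeasure (w : ℝ → ℝ) : Measure ℝ :=
  (volume.restrict (Set.Ioo (0 : ℝ) 1)).withDensity fun t => ENNReal.ofReal (w t)

/-- The exponential `t ↦ e^{2 π i a t}` of real frequency `a`. -/
def expo (a : ℝ) (t : ℝ) : ℂ :=
  Complex.exp (2 * Real.pi * Complex.I * a * t)

/-- The family `E(Λ) = {e^{2 π i a t} : a ∈ Λ}`, as a subset of `L²(𝕋, w)`. -/
def expFamily (Λ : Set ℝ) (w : ℝ → ℝ) : Set (Lp ℂ 2 (weightedMeasure w)) :=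
  {f | ∃ a ∈ Λ, ⇑f =ᵐ[weightedMeasure w] expo a}

/-- `E(Λ)` is complete in `L²(𝕋, w)`: its closed linear span is the whole space. -/
def IsCompleteFamily (Λ : Set ℝ) (w : ℝ → ℝ) : Prop :=
  (Submodule.span ℂ (expFamily Λ w)).topologicalClosure = ⊤

/-- `∫₀¹ log w(t) dt = -∞`: the positive part of `log w` has a finite integral over `(0, 1)`
and the negative part an infinite one. -/
def LogIntegralEqNegInfty (w : ℝ → ℝ) : Prop :=
  (∫⁻ t in Set.Ioo (0 : ℝ) 1, ENNReal.ofReal (Real.log (w t))) < ⊤ ∧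
  (∫⁻ t in Set.Ioo (0 : ℝ) 1, ENNReal.ofReal (-Real.log (w t))) = ⊤

/-- Weights with a deep right-hand zero at the origin: positive, increasing and bounded on
`(0, 1)`, with divergent logarithmic integral. -/
structure DeepZeroWeight (w : ℝ → ℝ) : Prop where
  pos : ∀ t ∈ Set.Ioo (0 : ℝ) 1, 0 < w t
  increasing : StrictMonoOn w (Set.Ioo (0 : ℝ) 1)
  bounded : ∃ M : ℝ, ∀ t ∈ Set.Ioo (0 : ℝ) 1, w t ≤ M
  log_integral : LogIntegralEqNegInfty w

/-- `Γ` contains a subset `Γ₁` with `∑_{γ ∈ Γ₁} 1 / √γ = ∞` and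
`#(Γ₁ ∩ (0, x)) ≤ C (√x / log x) (1 + o(1))` as `x → ∞`. -/
def RegularlyDistributed (C : ℝ) (Γ : Set ℕ) : Prop :=
  ∃ Γ₁ ⊆ Γ, ¬ Summable (fun γ : Γ₁ => 1 / Real.sqrt ((γ : ℕ) : ℝ)) ∧
    ∃ r : ℝ → ℝ, Tendsto r atTop (nhds 0) ∧
      ∀ᶠ x : ℝ in atTop,
        (({γ ∈ Γ₁ | 0 < (γ : ℝ) ∧ (γ : ℝ) < x}.ncard : ℕ) : ℝ)
          ≤ C * (Real.sqrt x / Real.log x) * (1 + r x)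

/-- The set `{1, 2, 3, …} ∖ Γ`, viewed as a set of real frequencies. -/
def remainingFrequencies (Γ : Set ℕ) : Set ℝ :=
  (fun n : ℕ => (n : ℝ)) '' {n : ℕ | 1 ≤ n ∧ n ∉ Γ}

end

/-! Noncompleteness is shown by duality: there are exponential sums `f` that annihilate every
remaining frequency, have mean `1/6`, and are dominated in the limit by a multiple of `√w`.
Approximating the constant `1` by the span in `L²(w)` would then contradict the mean.

Let `E(z) = (z+2)(z+3) ∏ (1 - z/g) ∏ (1 + z/k²)`, with `g` in the sparse set and both products
truncated. The coefficients of `f` are the residues of `1/(z E(z))` at its integer poles. All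
positive poles lie in the sparse set, so `f` annihilates the other positive frequencies, and its
mean is `1/E(0) = 1/6`. Fourier inversion on the line `Im z = y` gives `|f(t)| ≤ B e^{2πyt}`, where
`B` bounds `(1+x²)/|zE(z)|` there (`norm_expSum_le`).

The lower bound on `E` is `min_exp_le_mul_norm`. With `n(S)` the number of `g < S`, the two products
together are at least a constant times `min(e^{y/(5√S)}, e^{n(S)/5}) / |z|`. On the left the sparse
product grows, and the square product has the size of a sine. On the right the square product grows
like `e^{c√|z|}` and outweighs the sparse one, whose possible smallness is controlled by the `√x /
log x` density.

Choosing `S = (20πt)⁻²` and then `y` according to `n(S)` gives `|f(t)| ≲ e^{-n(S)/10}`. This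
dictates the weight `(1+t) e^{-n(S)/5}`, whose logarithmic integral diverges because `∫ n((20πt)⁻²)
dt` is comparable to `∑ 1/√g`. -/

open scoped FourierTransform

/-! ### Exponential sums with prescribed residues, bounded by Fourier inversion. -/

/-- The exponential sum `∑ c_p e^{-2π i p t}` over a finite set of integers. -/
noncomputable def expSum (S : Finset ℤ) (c : ℤ → ℂ) (t : ℝ) : ℂ :=
  ∑ p ∈ S, c p * expo (-(p : ℝ)) t

theorem continuous_expo (a : ℝ) : Continuous (expo a) := by
  unfold expo; fun_prop

theorem expo_mul (a b t : ℝ) : expo a t * expo b t = expo (a + b) t := by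
  simp only [expo, ← Complex.exp_add]; push_cast; ring_nf

theorem continuous_expSum (S : Finset ℤ) (c : ℤ → ℂ) : Continuous (expSum S c) := by
  unfold expSum
  exact continuous_finsetSum _ fun p _ => continuous_const.mul (continuous_expo _)

theorem integral_expo_int (n : ℤ) : ∫ t in Set.Ioo (0 : ℝ) 1, expo n t = if n = 0 then 1 else 0 := by
  rw [← integral_Ioc_eq_integral_Ioo, ← intervalIntegral.integral_of_le zero_le_one]
  split_ifs with h
  · simp [h, expo]
  · have hne : 2 * (Real.pi : ℂ) * Complex.I * n ≠ 0 := by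
      simp [Real.pi_ne_zero, h]
    have : ∀ t : ℝ, expo n t = Complex.exp (2 * Real.pi * Complex.I * n * t) := by
      intro t; simp [expo]
    simp_rw [this]
    rw [integral_exp_mul_complex hne]
    have : Complex.exp (2 * Real.pi * Complex.I * n * (1 : ℝ)) = 1 := by
      rw [Complex.exp_eq_one_iff]
      exact ⟨n, by push_cast; ring⟩
    rw [this]; simp

theorem integrable_expo (a : ℝ) : IntegrableOn (expo a) (Set.Ioo (0 : ℝ) 1) :=
  ((continuous_expo a).integrableOn_Icc).mono_set Set.Ioo_subset_Icc_self

theorem integral_expSum_mul_expo (S : Finset ℤ) (c : ℤ → ℂ) (n : ℤ) :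
    ∫ t in Set.Ioo (0 : ℝ) 1, expSum S c t * expo n t = if n ∈ S then c n else 0 := by
  have h1 : ∀ t : ℝ, expSum S c t * expo n t = ∑ p ∈ S, c p * expo ((n - p : ℤ) : ℝ) t := by
    intro t
    rw [expSum, Finset.sum_mul]
    refine Finset.sum_congr rfl fun p _ => ?_
    rw [mul_assoc, expo_mul]; congr 2; push_cast; ring
  simp_rw [h1]
  rw [integral_finsetSum _ fun p _ => (integrable_expo _).const_mul _]
  simp_rw [integral_const_mul, integral_expo_int]
  simp [sub_eq_zero]

theorem exp_shift_eq (p : ℤ) (y ξ t : ℝ) :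
    Complex.exp (↑(-2 * Real.pi * t * ξ) * Complex.I) *
      (expo (-(p : ℝ)) t * Complex.exp (-(2 * Real.pi * y * t : ℝ))) =
    Complex.exp ((2 * Real.pi * Complex.I * ((-ξ + y * Complex.I) - p)) * t) := by
  rw [expo, ← Complex.exp_add, ← Complex.exp_add]
  congr 1
  push_cast
  linear_combination (-2 * Real.pi * y * t) * Complex.I_sq

theorem shift_re_neg (p : ℤ) {y : ℝ} (hy : 0 < y) (ξ : ℝ) :
    (2 * Real.pi * Complex.I * ((-ξ + y * Complex.I) - p)).re < 0 := by
  have : (2 * Real.pi * Complex.I * ((-ξ + y * Complex.I) - p)).re = -(2 * Real.pi * y) := by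
    simp
  rw [this]
  have := Real.pi_pos
  nlinarith [mul_pos this hy]

/-- The damped one-sided exponential sum. -/
noncomputable def dampedSum (S : Finset ℤ) (c : ℤ → ℂ) (y : ℝ) : ℝ → ℂ :=
  (Set.Ioi (0 : ℝ)).indicator fun t => expSum S c t * Complex.exp (-(2 * Real.pi * y * t : ℝ))

theorem integrable_dampedSum (S : Finset ℤ) (c : ℤ → ℂ) {y : ℝ} (hy : 0 < y) :
    Integrable (dampedSum S c y) := by
  rw [dampedSum, integrable_indicator_iff measurableSet_Ioi]
  simp only [expSum, Finset.sum_mul]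
  refine integrable_finsetSum _ fun p _ => ?_
  simp_rw [mul_assoc]
  refine Integrable.const_mul ?_ _
  have := integrableOn_exp_mul_complex_Ioi (shift_re_neg p hy 0) 0
  refine this.congr (Filter.Eventually.of_forall fun t => ?_)
  have := exp_shift_eq p y 0 t
  simp only [← this]
  simp [mul_assoc]

/-- Each damped exponential integrates over the half-line to a simple pole at `p`. The transform is
therefore the rational function with residues `c p`, read along the line of height `y`. -/
theorem fourier_dampedSum (S : Finset ℤ) (c : ℤ → ℂ) {y : ℝ} (hy : 0 < y) (ξ : ℝ) :
    𝓕 (dampedSum S c y) ξ =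
      -(2 * Real.pi * Complex.I)⁻¹ * ∑ p ∈ S, c p * ((-ξ + y * Complex.I) - p)⁻¹ := by
  rw [Real.fourier_real_eq_integral_exp_smul]
  have h1 : ∀ t : ℝ, Complex.exp (↑(-2 * Real.pi * t * ξ) * Complex.I) • dampedSum S c y t =
      (Set.Ioi (0 : ℝ)).indicator (fun t => ∑ p ∈ S, c p *
        Complex.exp ((2 * Real.pi * Complex.I * ((-ξ + y * Complex.I) - p)) * t)) t := by
    intro t
    unfold dampedSum
    by_cases ht : t ∈ Set.Ioi (0 : ℝ)
    · rw [Set.indicator_of_mem ht, Set.indicator_of_mem ht, expSum, Finset.sum_mul, smul_eq_mul,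
        Finset.mul_sum]
      refine Finset.sum_congr rfl fun p _ => ?_
      rw [← exp_shift_eq]; ring
    · rw [Set.indicator_of_notMem ht, Set.indicator_of_notMem ht, smul_zero]
  simp_rw [h1]
  rw [integral_indicator measurableSet_Ioi, integral_finsetSum _ fun p _ =>
    (integrableOn_exp_mul_complex_Ioi (shift_re_neg p hy ξ) 0).const_mul _, Finset.mul_sum]
  refine Finset.sum_congr rfl fun p _ => ?_
  rw [integral_const_mul, integral_exp_mul_complex_Ioi (shift_re_neg p hy ξ) 0]
  simp only [Complex.ofReal_zero, mul_zero, Complex.exp_zero, neg_div, one_div, mul_inv]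
  ring

/-- A pointwise bound for an exponential sum whose coefficients are the residues of a rational
function decaying quadratically on a horizontal line. -/
theorem norm_expSum_le (S : Finset ℤ) (c : ℤ → ℂ) {y B : ℝ} (hy : 0 < y)
    (hB : ∀ x : ℝ, ‖∑ p ∈ S, c p * ((x + y * Complex.I) - p)⁻¹‖ ≤ B * (1 + x ^ 2)⁻¹)
    {t : ℝ} (ht : 0 < t) : ‖expSum S c t‖ ≤ B * Real.exp (2 * Real.pi * y * t) := by
  have hpi := Real.pi_pos
  have hbd : ∀ ξ : ℝ, ‖𝓕 (dampedSum S c y) ξ‖ ≤ (2 * Real.pi)⁻¹ * (B * (1 + ξ ^ 2)⁻¹) := by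
    intro ξ
    rw [fourier_dampedSum S c hy, norm_mul]
    have h1 : ‖-(2 * (Real.pi : ℂ) * Complex.I)⁻¹‖ = (2 * Real.pi)⁻¹ := by
      simp [abs_of_pos hpi]
    rw [h1]
    have := hB (-ξ)
    rw [neg_sq] at this
    push_cast at this
    gcongr
  have hint : Integrable fun ξ : ℝ => (2 * Real.pi)⁻¹ * (B * (1 + ξ ^ 2)⁻¹) :=
    (integrable_inv_one_add_sq.const_mul _).const_mul _
  have hg := integrable_dampedSum S c hy
  have hF : Integrable (𝓕 (dampedSum S c y)) := by
    refine hint.mono' ?_ (Eventually.of_forall hbd)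
    exact (VectorFourier.fourierIntegral_continuous Real.continuous_fourierChar
      (by exact continuous_inner) hg).aestronglyMeasurable
  have hcont : ContinuousAt (dampedSum S c y) t := by
    have : ContinuousAt (fun t : ℝ => expSum S c t * Complex.exp (-(2 * Real.pi * y * t : ℝ))) t :=
      ((continuous_expSum S c).mul (by fun_prop)).continuousAt
    refine this.congr ?_
    filter_upwards [Ioi_mem_nhds ht] with s hs
    rw [dampedSum, Set.indicator_of_mem hs]
  -- The damped sum may jump only at `0`, so inversion is available at every `t > 0`.
  have hinv := hg.fourierInv_fourier_eq hF hcont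
  have h2 : ‖dampedSum S c y t‖ ≤ ∫ ξ : ℝ, (2 * Real.pi)⁻¹ * (B * (1 + ξ ^ 2)⁻¹) := by
    rw [← hinv, Real.fourierInv_eq]
    refine norm_integral_le_of_norm_le hint (Eventually.of_forall fun ξ => ?_)
    rw [Circle.norm_smul]
    exact hbd ξ
  rw [integral_const_mul, integral_const_mul, integral_univ_inv_one_add_sq] at h2
  have hB0 : 0 ≤ B := by
    have := (norm_nonneg _).trans (hB 0)
    simpa using this
  have h3 : ‖dampedSum S c y t‖ ≤ B := by
    refine h2.trans ?_
    have : (2 * Real.pi)⁻¹ * (B * Real.pi) = B / 2 := by field_simp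
    rw [this]; linarith
  rw [dampedSum, Set.indicator_of_mem (Set.mem_Ioi.2 ht), norm_mul, Complex.norm_exp] at h3
  have h4 : (-((2 * Real.pi * y * t : ℝ) : ℂ)).re = -(2 * Real.pi * y * t) := by
    rw [Complex.neg_re, Complex.ofReal_re]
  rw [h4, Real.exp_neg] at h3
  rwa [← div_eq_mul_inv, div_le_iff₀ (Real.exp_pos _)] at h3

/-- Partial fractions of the reciprocal of a product of distinct linear factors. -/
theorem sum_nodalWeight_mul_inv (S : Finset ℤ) (hS : S.Nonempty) {z : ℂ} (hz : ∀ p ∈ S, z ≠ (p : ℂ)) :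
    ∑ p ∈ S, Lagrange.nodalWeight S (fun p : ℤ => (p : ℂ)) p * (z - p)⁻¹ =
      (∏ p ∈ S, (z - p))⁻¹ := by
  have hinj : Set.InjOn (fun p : ℤ => (p : ℂ)) S := Int.cast_injective.injOn
  -- The Lagrange basis sums to the constant `1`; evaluating at `z` off the nodes and dividing by
  -- the nodal polynomial gives the partial fractions.
  have h := congrArg (Polynomial.eval z) (Lagrange.sum_basis hinj hS)
  rw [Polynomial.eval_finsetSum, Polynomial.eval_one, Finset.sum_congr rfl fun p hp =>
    Lagrange.eval_basis_not_at_node hp (hz p hp), ← Finset.mul_sum, Lagrange.eval_nodal] at h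
  exact eq_inv_of_mul_eq_one_right h

/-- Finite exponential sums attached to a polynomial `z E(z)` with simple integer zeros. -/
theorem exists_expSum_of_simple_zeros (S₀ : Finset ℤ) (h0 : (0 : ℤ) ∉ S₀) (κ : ℂ)
    (E : ℂ → ℂ) (hE : ∀ z, E z = κ * ∏ p ∈ S₀, (z - p)) :
    ∃ f : ℝ → ℂ, Continuous f ∧
      (∀ n : ℤ, n ∉ insert 0 S₀ → ∫ t in Set.Ioo (0 : ℝ) 1, f t * expo n t = 0) ∧
      (∫ t in Set.Ioo (0 : ℝ) 1, f t = (E 0)⁻¹) ∧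
      ∀ y B : ℝ, 0 < y → (∀ x : ℝ, ‖((x + y * Complex.I) * E (x + y * Complex.I))⁻¹‖ ≤
        B * (1 + x ^ 2)⁻¹) → ∀ t : ℝ, 0 < t → ‖f t‖ ≤ B * Real.exp (2 * Real.pi * y * t) := by
  set S := insert 0 S₀ with hS
  -- The residues of `1/(z E(z))`; the one at `0` is `1/E(0)`, which is the mean of the sum.
  set c : ℤ → ℂ := fun p => κ⁻¹ * Lagrange.nodalWeight S (fun p : ℤ => (p : ℂ)) p with hc
  refine ⟨expSum S c, continuous_expSum S c, fun n hn => ?_, ?_, fun y B hy hB t ht => ?_⟩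
  · rw [integral_expSum_mul_expo, if_neg hn]
  · have := integral_expSum_mul_expo S c 0
    rw [if_pos (by simp [hS])] at this
    have h1 : ∀ t : ℝ, expo ((0 : ℤ) : ℝ) t = 1 := by intro t; simp [expo]
    simp only [h1, mul_one] at this
    rw [this, hc, hE]
    simp only [Lagrange.nodalWeight, hS, Finset.erase_insert h0, Finset.prod_inv_distrib,
      Int.cast_zero, mul_inv]
  · refine norm_expSum_le S c hy (fun x => ?_) ht
    have hne : ∀ p ∈ S, (x + y * Complex.I : ℂ) ≠ (p : ℂ) := by
      intro p _ h
      have := congrArg Complex.im h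
      simp at this
      exact hy.ne' this
    have h2 := sum_nodalWeight_mul_inv S (Finset.insert_nonempty _ _) hne
    have h3 : ∑ p ∈ S, c p * ((x + y * Complex.I) - p)⁻¹ =
        ((x + y * Complex.I) * E (x + y * Complex.I))⁻¹ := by
      simp only [hc, mul_assoc]
      rw [← Finset.mul_sum, h2, hE, hS, Finset.prod_insert h0, ← mul_inv]
      congr 1; push_cast; ring
    rw [h3]
    exact hB x

/-! ### Counting function and the two canonical products. -/

open Classical in
/-- The number of elements of `G` that are less than `x`. -/
noncomputable def countBelow (G : Set ℕ) (x : ℝ) : ℕ :=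
  ((Finset.range ⌈x⌉₊).filter (· ∈ G)).card

open Classical in
/-- The polynomial `∏ (1 - z / g)` over the elements `g < N` of `G`. -/
noncomputable def sparseProd (G : Set ℕ) (N : ℕ) (z : ℂ) : ℂ :=
  ∏ g ∈ (Finset.range N).filter (· ∈ G), (1 - z / g)

/-- The polynomial `∏ (1 + z / k ^ 2)` over `1 ≤ k ≤ M`. -/
noncomputable def squareProd (M : ℕ) (z : ℂ) : ℂ :=
  ∏ k ∈ Finset.range M, (1 + z / ((k : ℂ) + 1) ^ 2)

open Classical in
theorem countBelow_mono (G : Set ℕ) {x y : ℝ} (h : x ≤ y) : countBelow G x ≤ countBelow G y := by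
  refine Finset.card_le_card (Finset.filter_subset_filter _ ?_)
  exact Finset.range_subset_range.2 (Nat.ceil_le_ceil h)

open Classical in
theorem countBelow_of_le_one {G : Set ℕ} (hG : 0 ∉ G) {x : ℝ} (h : x ≤ 1) : countBelow G x = 0 := by
  rw [countBelow, Finset.card_eq_zero, Finset.filter_eq_empty_iff]
  intro g hg hgG
  rw [Finset.mem_range, Nat.lt_ceil] at hg
  have : g < 1 := by exact_mod_cast hg.trans_le h
  obtain rfl : g = 0 := by omega
  exact hG hgG

open Classical in
theorem countBelow_succ (G : Set ℕ) (n : ℕ) :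
    countBelow G ((n + 1 : ℕ) : ℝ) = countBelow G n + if n ∈ G then 1 else 0 := by
  simp only [countBelow, Nat.ceil_natCast]
  rw [Finset.range_add_one, Finset.filter_insert]
  split_ifs with h
  · rw [Finset.card_insert_of_notMem (by simp)]
  · rfl

/-! ### Lower bounds for each product separately. -/

theorem normSq_one_sub_div (z : ℂ) (a : ℝ) :
    ‖1 - z / a‖ ^ 2 = (1 - z.re / a) ^ 2 + (z.im / a) ^ 2 := by
  rw [← Complex.normSq_eq_norm_sq, Complex.normSq_apply]
  simp [Complex.div_ofReal_re, Complex.div_ofReal_im]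
  ring

theorem norm_sq_eq_re_im (z : ℂ) : ‖z‖ ^ 2 = z.re ^ 2 + z.im ^ 2 := by
  rw [← Complex.normSq_eq_norm_sq, Complex.normSq_apply]; ring

theorem one_add_sq_le_of_re_nonpos {z : ℂ} (hz : z.re ≤ 0) {a : ℝ} (ha : 0 < a) :
    1 + ‖z‖ ^ 2 / a ^ 2 ≤ ‖1 - z / a‖ ^ 2 := by
  rw [normSq_one_sub_div, norm_sq_eq_re_im]
  have : z.re / a ≤ 0 := div_nonpos_of_nonpos_of_nonneg hz ha.le
  have h2 : (z.re ^ 2 + z.im ^ 2) / a ^ 2 = (z.re / a) ^ 2 + (z.im / a) ^ 2 := by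
    rw [div_pow, div_pow, add_div]
  rw [h2]; nlinarith

/-- The exponent `17/50` lies just below `(log 2)/2`. -/
theorem exp_le_of_two_le_sq {r : ℝ} (hr : 0 ≤ r) (h : 2 ≤ r ^ 2) : Real.exp (17 / 50) ≤ r := by
  refine le_of_sq_le_sq ?_ hr
  rw [← Real.exp_nat_mul]
  refine le_trans ?_ h
  rw [← Real.le_log_iff_exp_le two_pos]
  have := Real.log_two_gt_d9
  push_cast; linarith

theorem exp_mul_card_le_norm_prod {ι : Type*} {s t : Finset ι} (hts : t ⊆ s) (F : ι → ℂ) (b : ℝ)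
    (h1 : ∀ i ∈ s, 1 ≤ ‖F i‖) (h2 : ∀ i ∈ t, Real.exp b ≤ ‖F i‖) :
    Real.exp (b * t.card) ≤ ‖∏ i ∈ s, F i‖ := by
  classical
  rw [norm_prod, mul_comm, Real.exp_nat_mul, ← Finset.prod_sdiff hts]
  have h3 : Real.exp b ^ t.card ≤ ∏ i ∈ t, ‖F i‖ := by
    rw [← Finset.prod_const]
    exact Finset.prod_le_prod (fun _ _ => (Real.exp_pos _).le) h2
  have h4 : 1 ≤ ∏ i ∈ s \ t, ‖F i‖ := by
    refine Finset.one_le_prod fun i hi => ?_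
    exact h1 i (Finset.mem_sdiff.1 hi).1
  have h5 : 0 ≤ Real.exp b ^ t.card := by positivity
  nlinarith

/-- In the left half-plane no factor has modulus below `1`, and each factor with `g < S ≤ ‖z‖` has
modulus at least `√2`. -/
theorem le_norm_sparseProd_of_re_nonpos {G : Set ℕ} (hG : 0 ∉ G) {z : ℂ} (hz : z.re ≤ 0) {S : ℝ}
    (hS : S ≤ ‖z‖) {N : ℕ} (hN : S ≤ N) :
    Real.exp (countBelow G S / 5) ≤ ‖sparseProd G N z‖ := by
  classical
  have hpos : ∀ g ∈ G, (0 : ℝ) < g := fun g hg =>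
    Nat.cast_pos.2 (Nat.pos_of_ne_zero fun h => hG (h ▸ hg))
  have hsub : (Finset.range ⌈S⌉₊).filter (· ∈ G) ⊆ (Finset.range N).filter (· ∈ G) :=
    Finset.filter_subset_filter _ (Finset.range_subset_range.2 (Nat.ceil_le.2 hN))
  have h := exp_mul_card_le_norm_prod hsub (fun g : ℕ => 1 - z / g) (17 / 50)
    (fun g hg => ?_) (fun g hg => ?_)
  · refine le_trans (Real.exp_le_exp.2 ?_) (le_of_le_of_eq h ?_)
    · have h0 : (0 : ℝ) ≤ countBelow G S := Nat.cast_nonneg _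
      have : (countBelow G S : ℝ) = (((Finset.range ⌈S⌉₊).filter (· ∈ G)).card : ℝ) := by
        rw [countBelow]
      rw [← this]; linarith
    · rw [sparseProd]
  · have := one_add_sq_le_of_re_nonpos hz (hpos g (Finset.mem_filter.1 hg).2)
    have h2 : 0 ≤ ‖z‖ ^ 2 / (g : ℝ) ^ 2 := by positivity
    rw [Complex.ofReal_natCast] at this
    exact le_of_sq_le_sq (by linarith) (norm_nonneg _)
  · have hg' := Finset.mem_filter.1 hg
    have hg0 := hpos g hg'.2
    have := one_add_sq_le_of_re_nonpos hz hg0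
    rw [Complex.ofReal_natCast] at this
    refine exp_le_of_two_le_sq (norm_nonneg _) (le_trans ?_ this)
    have hgS : (g : ℝ) < S := Nat.lt_ceil.1 (Finset.mem_range.1 hg'.1)
    have : 1 ≤ ‖z‖ ^ 2 / (g : ℝ) ^ 2 := by
      rw [one_le_div (by positivity)]
      exact pow_le_pow_left₀ hg0.le (hgS.le.trans hS) 2
    linarith

theorem squareProd_factor_eq (z : ℂ) (k : ℕ) :
    1 + z / ((k : ℂ) + 1) ^ 2 = 1 - (-z) / (((k + 1 : ℝ) ^ 2 : ℝ) : ℂ) := by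
  push_cast; ring

/-- The mirror image: the factors with `k² ≤ U` have modulus at least `√2`, and there are `⌊√U⌋` of
them. -/
theorem le_norm_squareProd_of_re_nonneg {z : ℂ} (hz : 0 ≤ z.re) {M : ℕ} {U : ℝ} (hU : 0 ≤ U)
    (hUz : U ≤ ‖z‖) (hM : U ≤ M ^ 2) :
    Real.exp (17 / 50 * (√U - 1)) ≤ ‖squareProd M z‖ := by
  have key : ∀ k : ℕ, 1 + ‖z‖ ^ 2 / ((k + 1 : ℝ) ^ 2) ^ 2 ≤ ‖1 + z / ((k : ℂ) + 1) ^ 2‖ ^ 2 := by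
    intro k
    rw [squareProd_factor_eq, ← norm_neg z]
    exact one_add_sq_le_of_re_nonpos (by simpa using hz) (by positivity)
  have hsub : Finset.range ⌊√U⌋₊ ⊆ Finset.range M := by
    refine Finset.range_subset_range.2 ?_
    have : √U ≤ M := Real.sqrt_le_iff.2 ⟨by positivity, hM⟩
    exact Nat.cast_le.1 ((Nat.floor_le (Real.sqrt_nonneg U)).trans this)
  have h := exp_mul_card_le_norm_prod hsub (fun k : ℕ => 1 + z / ((k : ℂ) + 1) ^ 2) (17 / 50)
    (fun k _ => ?_) (fun k hk => ?_)
  · refine le_trans (Real.exp_le_exp.2 ?_) h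
    rw [Finset.card_range]
    have := Nat.lt_floor_add_one √U
    linarith
  · have := key k
    have h2 : 0 ≤ ‖z‖ ^ 2 / (((k + 1 : ℝ) ^ 2) ^ 2) := by positivity
    exact le_of_sq_le_sq (by linarith) (norm_nonneg _)
  · refine exp_le_of_two_le_sq (norm_nonneg _) (le_trans ?_ (key k))
    have hk1 : ((k + 1 : ℕ) : ℝ) ≤ √U :=
      (Nat.cast_le.2 (Finset.mem_range.1 hk)).trans (Nat.floor_le (Real.sqrt_nonneg U))
    push_cast at hk1
    have h3 : (k + 1 : ℝ) ^ 2 ≤ U := by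
      have := pow_le_pow_left₀ (by positivity) hk1 2
      rwa [Real.sq_sqrt hU] at this
    have : 1 ≤ ‖z‖ ^ 2 / ((k + 1 : ℝ) ^ 2) ^ 2 := by
      rw [one_le_div (by positivity)]
      exact pow_le_pow_left₀ (by positivity) (h3.trans hUz) 2
    linarith

theorem one_le_norm_squareProd_of_re_le {z : ℂ} {M : ℕ} (hz : z.re ≤ -(2 * M ^ 2)) :
    1 ≤ ‖squareProd M z‖ := by
  rw [squareProd, norm_prod]
  refine Finset.one_le_prod fun k hk => ?_
  have hk1 : (k + 1 : ℝ) ≤ M := by exact_mod_cast Finset.mem_range.1 hk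
  refine le_of_sq_le_sq ?_ (norm_nonneg _)
  rw [squareProd_factor_eq, normSq_one_sub_div]
  have h1 : 2 ≤ (-z).re / (k + 1 : ℝ) ^ 2 := by
    rw [le_div_iff₀ (by positivity), Complex.neg_re]
    have := pow_le_pow_left₀ (by positivity) hk1 2
    linarith
  nlinarith [sq_nonneg ((-z).im / (k + 1 : ℝ) ^ 2)]

/-- For `k > M` the real part of `1 + z/k²` lies in `[-1, 1]`, so a factor can exceed `1` only
through `(z.im/k²)²`, and these excesses telescope. This lets a finite product stand in for the full
sine product when `z.im² ≤ M`. -/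
theorem norm_squareProd_le_mul {z : ℂ} (hz : z.re ≤ 0) {M : ℕ} (hM : 1 ≤ M)
    (hzM : -(2 * M ^ 2) ≤ z.re) {n : ℕ} (hn : M ≤ n) :
    ‖squareProd n z‖ ≤ ‖squareProd M z‖ * Real.exp (z.im ^ 2 * (1 / M - 1 / n)) := by
  induction n, hn using Nat.le_induction with
  | base => simp
  | succ n hn ih =>
    have hn0 : (0 : ℝ) < n := Nat.cast_pos.2 (hM.trans hn)
    have hMn : (M : ℝ) ≤ n := Nat.cast_le.2 hn
    have hfac : ‖1 + z / ((n : ℂ) + 1) ^ 2‖ ≤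
        Real.exp (z.im ^ 2 * (1 / n - 1 / (n + 1 : ℕ))) := by
      refine le_of_sq_le_sq ?_ (Real.exp_pos _).le
      rw [squareProd_factor_eq, normSq_one_sub_div, ← Real.exp_nat_mul]
      have h1 : 0 ≤ (-z).re / (n + 1 : ℝ) ^ 2 := by
        rw [Complex.neg_re]; exact div_nonneg (by linarith) (by positivity)
      have h2 : (-z).re / (n + 1 : ℝ) ^ 2 ≤ 2 := by
        rw [div_le_iff₀ (by positivity), Complex.neg_re]; nlinarith
      have h3 : ((-z).im / (n + 1 : ℝ) ^ 2) ^ 2 ≤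
          ((2 : ℕ) : ℝ) * (z.im ^ 2 * (1 / n - 1 / (n + 1 : ℕ))) := by
        have e1 : (1 / (n : ℝ) - 1 / (n + 1 : ℕ)) = 1 / (n * (n + 1)) := by
          push_cast; field_simp; ring
        rw [e1, Complex.neg_im, div_pow, neg_sq, div_eq_mul_one_div]
        have : 1 / ((n + 1 : ℝ) ^ 2) ^ 2 ≤ 2 * (1 / (n * (n + 1))) := by
          have : 1 / ((n + 1 : ℝ) ^ 2) ^ 2 ≤ 1 / (n * (n + 1)) := by
            refine one_div_le_one_div_of_le (by positivity) ?_
            have : 1 ≤ (n + 1 : ℝ) ^ 2 := by nlinarith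
            nlinarith
          have h0 : 0 < 1 / (n * (n + 1) : ℝ) := by positivity
          linarith
        push_cast
        nlinarith [mul_le_mul_of_nonneg_left this (sq_nonneg z.im)]
      have h4 := Real.add_one_le_exp (((2 : ℕ) : ℝ) * (z.im ^ 2 * (1 / n - 1 / (n + 1 : ℕ))))
      nlinarith
    rw [squareProd, Finset.prod_range_succ, norm_mul, ← squareProd]
    calc _ ≤ (‖squareProd M z‖ * Real.exp (z.im ^ 2 * (1 / M - 1 / n))) *
          Real.exp (z.im ^ 2 * (1 / n - 1 / (n + 1 : ℕ))) :=
          mul_le_mul ih hfac (norm_nonneg _) (by positivity)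
      _ = _ := by rw [mul_assoc, ← Real.exp_add]; ring_nf

theorem sinh_abs_im_le_norm_sin (w : ℂ) : Real.sinh |w.im| ≤ ‖Complex.sin w‖ := by
  refine le_of_sq_le_sq ?_ (norm_nonneg _)
  have h1 : Real.sinh |w.im| ^ 2 = Real.sinh w.im ^ 2 := by
    rcases abs_choice w.im with h | h <;> rw [h]
    rw [Real.sinh_neg, neg_sq]
  have h2 : Complex.sin w = ((Real.sin w.re * Real.cosh w.im : ℝ) : ℂ) +
      ((Real.cos w.re * Real.sinh w.im : ℝ) : ℂ) * Complex.I := by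
    conv_lhs => rw [← Complex.re_add_im w, Complex.sin_add_mul_I]
    push_cast; ring
  rw [h1, h2, ← Complex.normSq_eq_norm_sq, Complex.normSq_add_mul_I]
  have := Real.cosh_sq w.im
  have := Real.sin_sq_add_cos_sq w.re
  nlinarith [sq_nonneg (Real.sin w.re)]

theorem exp_mul_div_le_sinh {s : ℝ} (hs : 0 ≤ s) : Real.exp s * (s / (1 + 2 * s)) ≤ Real.sinh s := by
  rw [Real.sinh_eq]
  have h1 := Real.add_one_le_exp (2 * s)
  have h2 : Real.exp (-s) = Real.exp s * Real.exp (-(2 * s)) := by rw [← Real.exp_add]; ring_nf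
  have h3 : Real.exp (-(2 * s)) ≤ 1 / (1 + 2 * s) := by
    rw [Real.exp_neg, ← one_div]
    exact one_div_le_one_div_of_le (by positivity) (by linarith)
  have h4 : s / (1 + 2 * s) = (1 - 1 / (1 + 2 * s)) / 2 := by field_simp; ring
  rw [h2, h4]
  nlinarith [mul_le_mul_of_nonneg_left h3 (Real.exp_pos s).le]

/-- With `w² = -z`, the infinite product is `sin(πw)/(πw)`, and `|sin(πw)| ≥ sinh(π|Im w|)`. Since
`|Re w| ≤ √‖z‖` and `2 Re w Im w = -Im z`, one has `|Im w| ≥ Im z/(2√‖z‖)`. Truncation costs only a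
factor `e`. -/
theorem le_norm_squareProd_of_re_nonpos {z : ℂ} (hz : z.re ≤ 0) (hy : 1 ≤ z.im) {M : ℕ} (hM : 1 ≤ M)
    (hzM : -(2 * M ^ 2) ≤ z.re) (hyM : z.im ^ 2 ≤ M) :
    Real.exp (z.im / (5 * √‖z‖)) ≤ 25 * ‖z‖ * ‖squareProd M z‖ := by
  have hR : 1 ≤ ‖z‖ := hy.trans ((le_abs_self _).trans (Complex.abs_im_le_norm z))
  obtain ⟨w, hw⟩ := IsAlgClosed.exists_pow_nat_eq (-z) (n := 2) two_pos
  set r := √‖z‖ with hr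
  have hr1 : 1 ≤ r := Real.one_le_sqrt.2 hR
  have hr2 : r ^ 2 = ‖z‖ := Real.sq_sqrt (norm_nonneg _)
  have hwr : ‖w‖ = r := by
    rw [hr, ← norm_neg z, ← hw, norm_pow, Real.sqrt_sq (norm_nonneg _)]
  have hpi := Real.pi_gt_three
  have hpi' := Real.pi_lt_d2
  have hM0 : (0 : ℝ) < M := Nat.cast_pos.2 hM
  have hlim : ‖Complex.sin (Real.pi * w)‖ ≤
      Real.pi * r * (‖squareProd M z‖ * Real.exp 1) := by
    refine le_of_tendsto (Complex.tendsto_euler_sin_prod w).norm ?_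
    filter_upwards [eventually_ge_atTop M] with n hn
    have e1 : ∏ j ∈ Finset.range n, ((1 : ℂ) - w ^ 2 / ((j : ℂ) + 1) ^ 2) = squareProd n z := by
      rw [squareProd]
      refine Finset.prod_congr rfl fun k _ => ?_
      rw [hw]; ring
    rw [e1, norm_mul, norm_mul, hwr, Complex.norm_real, Real.norm_of_nonneg (by linarith)]
    refine mul_le_mul_of_nonneg_left ?_ (by positivity)
    refine (norm_squareProd_le_mul hz hM hzM hn).trans ?_
    refine mul_le_mul_of_nonneg_left (Real.exp_le_exp.2 ?_) (norm_nonneg _)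
    have h1 : (0 : ℝ) ≤ 1 / n := by positivity
    calc z.im ^ 2 * (1 / M - 1 / n) ≤ M * (1 / M) :=
          mul_le_mul hyM (by linarith) (by
            have : (M : ℝ) ≤ n := Nat.cast_le.2 hn
            exact sub_nonneg.2 (one_div_le_one_div_of_le hM0 this)) (by positivity)
      _ = 1 := by field_simp
  have him : z.im / (2 * r) ≤ |w.im| := by
    rw [div_le_iff₀ (by positivity)]
    have h1 : 2 * (w.re * w.im) = -z.im := by
      have := congrArg Complex.im hw
      rw [pow_two, Complex.mul_im, Complex.neg_im] at this
      linarith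
    have h2 : |w.re| ≤ r := hwr ▸ Complex.abs_re_le_norm w
    have h3 : z.im = 2 * (|w.re| * |w.im|) := by
      have h4 := congrArg abs h1
      rw [abs_mul, abs_mul, abs_neg, abs_of_nonneg (show 0 ≤ z.im by linarith), abs_two] at h4
      exact h4.symm
    nlinarith [mul_le_mul_of_nonneg_right h2 (abs_nonneg w.im)]
  set s := Real.pi * (z.im / (2 * r)) with hs
  have hs0 : Real.pi / (2 * r) ≤ s := by
    rw [hs, ← mul_div_assoc]
    gcongr
    nlinarith
  have hspos : 0 < s := lt_of_lt_of_le (by positivity) hs0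
  have h1 : Real.sinh s ≤ ‖Complex.sin (Real.pi * w)‖ := by
    refine le_trans ?_ (sinh_abs_im_le_norm_sin _)
    rw [Real.sinh_le_sinh, Complex.im_ofReal_mul, abs_mul, abs_of_pos Real.pi_pos]
    exact mul_le_mul_of_nonneg_left him Real.pi_pos.le
  have h2 := (exp_mul_div_le_sinh hspos.le).trans (h1.trans hlim)
  have h3 : Real.pi / (2 * (1 + Real.pi) * r) ≤ s / (1 + 2 * s) := by
    rw [div_le_div_iff₀ (by positivity) (by positivity)]
    rw [div_le_iff₀ (by positivity)] at hs0
    nlinarith [mul_pos Real.pi_pos hspos]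
  have h4 : Real.exp (z.im / (5 * r)) ≤ Real.exp s := by
    refine Real.exp_le_exp.2 ?_
    rw [hs, ← mul_div_assoc, div_le_div_iff₀ (by positivity) (by positivity)]
    have : 0 < z.im * r := by positivity
    nlinarith
  have h5 : Real.exp s * (Real.pi / (2 * (1 + Real.pi) * r)) ≤
      Real.pi * r * (‖squareProd M z‖ * Real.exp 1) :=
    (mul_le_mul_of_nonneg_left h3 (Real.exp_pos _).le).trans h2
  rw [← mul_div_assoc, div_le_iff₀ (by positivity)] at h5
  have h6 : Real.exp s ≤ 2 * (1 + Real.pi) * Real.exp 1 * (‖z‖ * ‖squareProd M z‖) := by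
    rw [← hr2]
    refine le_of_mul_le_mul_right ?_ Real.pi_pos
    linarith
  have h7 : 2 * (1 + Real.pi) * Real.exp 1 ≤ 25 := by
    have := Real.exp_one_lt_d9
    nlinarith [Real.exp_pos 1]
  calc _ ≤ _ := h4
    _ ≤ _ := h6
    _ ≤ 25 * (‖z‖ * ‖squareProd M z‖) := mul_le_mul_of_nonneg_right h7 (by positivity)
    _ = _ := by ring

open Classical in
theorem sum_inv_tail_le {G : Set ℕ} {ε K : ℝ} (hε : 0 ≤ ε) (hK : 0 ≤ K)
    (h : ∀ x : ℝ, 1 ≤ x → countBelow G x ≤ ε * √x + K) {m : ℕ} (hm : 1 ≤ m) (N : ℕ) :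
    ∑ g ∈ (Finset.range N).filter (fun g => g ∈ G ∧ m ≤ g), (1 / g : ℝ) ≤ 3 * ε / √m + K / m := by
  rcases le_or_gt m N with hmN | hmN
  swap
  · rw [Finset.sum_eq_zero]
    · positivity
    · intro g hg
      have := Finset.mem_filter.1 hg
      have := Finset.mem_range.1 this.1
      omega
  -- Abel summation as an induction: the boundary term `countBelow G N / N` is kept so that each
  -- step telescopes.
  have key : ∑ g ∈ (Finset.range N).filter (fun g => g ∈ G ∧ m ≤ g), (1 / g : ℝ) ≤
      countBelow G N / N + 3 * ε * (1 / √m - 1 / √N) + K * (1 / m - 1 / N) := by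
    induction N, hmN using Nat.le_induction with
    | base =>
      rw [Finset.sum_eq_zero]
      · simp only [sub_self, mul_zero, add_zero]; positivity
      · intro g hg
        have := Finset.mem_filter.1 hg
        have := Finset.mem_range.1 this.1
        omega
    | succ n hn ih =>
      have hn1 : 1 ≤ n := hm.trans hn
      have hn0 : (0 : ℝ) < n := Nat.cast_pos.2 hn1
      have hstep : ∑ g ∈ (Finset.range (n + 1)).filter (fun g => g ∈ G ∧ m ≤ g), (1 / g : ℝ) =
          ∑ g ∈ (Finset.range n).filter (fun g => g ∈ G ∧ m ≤ g), (1 / g : ℝ) +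
            (if n ∈ G then 1 else 0) / n := by
        rw [Finset.sum_filter, Finset.sum_filter, Finset.sum_range_succ]
        congr 1
        by_cases hnG : n ∈ G <;> simp [hnG, hn]
      have hc := countBelow_succ G n
      have hc' : (countBelow G ((n + 1 : ℕ) : ℝ) : ℝ) = countBelow G n + if n ∈ G then 1 else 0 := by
        rw [hc]; push_cast; rfl
      have hb := h ((n + 1 : ℕ) : ℝ) (by push_cast; linarith)
      set c := (countBelow G ((n + 1 : ℕ) : ℝ) : ℝ)
      set r := √(n : ℝ) with hr
      set q := √((n + 1 : ℕ) : ℝ) with hq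
      have hr0 : 0 < r := Real.sqrt_pos.2 hn0
      have hr2 : r ^ 2 = n := Real.sq_sqrt hn0.le
      have hq2 : q ^ 2 = n + 1 := by rw [hq, Real.sq_sqrt (by positivity)]; push_cast; rfl
      have hq0 : 0 < q := Real.sqrt_pos.2 (by positivity)
      have hq1 : q ≤ 2 * r := by
        have : (1 : ℝ) ≤ n := by exact_mod_cast hn1
        nlinarith
      have h1 : c / (n * (n + 1)) ≤ 3 * ε * (1 / r - 1 / q) + K * (1 / n - 1 / (n + 1 : ℕ)) := by
        have e1 : 1 / (n : ℝ) - 1 / (n + 1 : ℕ) = 1 / (n * (n + 1)) := by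
          push_cast; field_simp; ring
        have e2 : q / (n * (n + 1)) ≤ 3 * (1 / r - 1 / q) := by
          have : 1 / r - 1 / q = 1 / (r * q * (q + r)) := by
            field_simp; nlinarith
          rw [this, ← hq2, ← hr2, ← mul_div_assoc, div_le_div_iff₀ (by positivity) (by positivity)]
          have : 0 < r * q * q := by positivity
          nlinarith
        rw [e1]
        calc c / (n * (n + 1)) ≤ (ε * q + K) / (n * (n + 1)) := by gcongr
          _ = ε * (q / (n * (n + 1))) + K * (1 / (n * (n + 1))) := by ring
          _ ≤ ε * (3 * (1 / r - 1 / q)) + K * (1 / (n * (n + 1))) := by gcongr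
          _ = _ := by ring
      have h2 : (countBelow G n : ℝ) / n + (if n ∈ G then 1 else 0) / n =
          c / (n + 1 : ℕ) + c / (n * (n + 1)) := by
        rw [← add_div, ← hc']; push_cast; field_simp
      rw [hstep]
      linarith
  have hN0 : (0 : ℝ) < N := Nat.cast_pos.2 (hm.trans hmN)
  have hb := h N (by exact_mod_cast hm.trans hmN)
  have hs : √(N : ℝ) ^ 2 = N := Real.sq_sqrt hN0.le
  have hs0 : 0 < √(N : ℝ) := Real.sqrt_pos.2 hN0
  have h1 : (countBelow G N : ℝ) / N ≤ ε * (1 / √N) + K * (1 / N) := by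
    calc (countBelow G N : ℝ) / N ≤ (ε * √N + K) / N := by gcongr
      _ = ε * (√N / N) + K * (1 / N) := by ring
      _ = _ := by rw [Real.sqrt_div_self']
  have hm' : (0 : ℝ) < m := Nat.cast_pos.2 hm
  have h2 : 0 ≤ 1 / √(m : ℝ) := by positivity
  have h3 : 0 ≤ 1 / √(N : ℝ) := by positivity
  have h4 : 0 ≤ 1 / (N : ℝ) := by positivity
  calc _ ≤ _ := key
    _ ≤ 3 * ε * (1 / √m) + K * (1 / m) := by
      nlinarith [mul_nonneg hε h2, mul_nonneg hε h3]
    _ = _ := by ring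

theorem exp_neg_two_mul_le {u : ℝ} (h0 : 0 ≤ u) (h1 : u ≤ 1 / 2) : Real.exp (-(2 * u)) ≤ 1 - u := by
  rw [Real.exp_neg]
  have h2 := Real.add_one_le_exp (2 * u)
  refine (inv_anti₀ (by positivity) h2).trans ?_
  rw [inv_le_iff_one_le_mul₀ (by positivity)]
  nlinarith

/-- Factors with `g ≥ 2‖z‖` are handled by the tail of `∑ 1/g`. Each remaining factor has imaginary
part at least `1/(2‖z‖)` in modulus because `z.im ≥ 1`, so their total loss is the count times
`log(2‖z‖)`; here the logarithm in the density hypothesis is needed. -/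
theorem le_norm_sparseProd {G : Set ℕ} (hG : 0 ∉ G) {K : ℝ} (hK : 0 ≤ K)
    (hlog : ∀ x : ℝ, 1 ≤ x → countBelow G x * Real.log x ≤ 1 / 50 * √x + K)
    (hsqrt : ∀ x : ℝ, 1 ≤ x → countBelow G x ≤ 1 / 50 * √x + K)
    {z : ℂ} (hy : 1 ≤ z.im) (N : ℕ) :
    Real.exp (-(7 / 50 * √‖z‖ + 2 * K)) ≤ ‖sparseProd G N z‖ := by
  classical
  set R := ‖z‖ with hRdef
  have hR : 1 ≤ R := hy.trans ((le_abs_self _).trans (Complex.abs_im_le_norm z))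
  have hpos : ∀ g ∈ G, (0 : ℝ) < g := fun g hg =>
    Nat.cast_pos.2 (Nat.pos_of_ne_zero fun h => hG (h ▸ hg))
  set m := ⌈2 * R⌉₊ with hm
  have hm1 : 1 ≤ m := Nat.one_le_ceil_iff.2 (by linarith)
  set F : ℕ → ℝ := fun g => if m ≤ g then 2 * R * (1 / g) else Real.log (2 * R) with hF
  have hfac : ∀ g ∈ (Finset.range N).filter (· ∈ G), Real.exp (-F g) ≤ ‖1 - z / g‖ := by
    intro g hg
    have hg0 := hpos g (Finset.mem_filter.1 hg).2
    by_cases hmg : m ≤ g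
    · have h2 : 2 * R ≤ g := Nat.ceil_le.1 hmg
      have h3 : Real.exp (-(2 * (R / g))) ≤ 1 - R / g := by
        refine exp_neg_two_mul_le (by positivity) ?_
        rw [div_le_div_iff₀ hg0 two_pos]; linarith
      have h4 : 1 - R / g ≤ ‖1 - z / g‖ := by
        have := norm_sub_norm_le (1 : ℂ) (z / g)
        rwa [norm_one, norm_div, Complex.norm_natCast] at this
      simp only [hF, if_pos hmg]
      refine le_trans (le_of_eq ?_) (h3.trans h4)
      congr 1; ring
    · have h2 : (g : ℝ) < 2 * R := Nat.lt_ceil.1 (not_le.1 hmg)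
      simp only [hF, if_neg hmg]
      rw [Real.exp_neg, Real.exp_log (by positivity)]
      have h3 := Complex.abs_im_le_norm (1 - z / g)
      have h4 : (1 - z / (g : ℂ)).im = -(z.im / g) := by
        have := Complex.div_ofReal_im z (g : ℝ)
        rw [Complex.ofReal_natCast] at this
        rw [Complex.sub_im, Complex.one_im, this]; ring
      rw [h4, abs_neg] at h3
      refine le_trans ?_ ((le_abs_self _).trans h3)
      rw [← one_div]
      exact div_le_div₀ (by linarith) hy hg0 h2.le
  have hsum : ∑ g ∈ (Finset.range N).filter (· ∈ G), F g ≤ 7 / 50 * √R + 2 * K := by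
    rw [Finset.sum_ite, Finset.sum_const, Finset.filter_filter, Finset.filter_filter, ← Finset.mul_sum]
    have h1 := sum_inv_tail_le (by norm_num) hK hsqrt hm1 N
    have hmR : 2 * R ≤ m := Nat.le_ceil _
    have h2 : 2 * R * (3 * (1 / 50) / √m + K / m) ≤ 3 / 50 * √(2 * R) + K := by
      have e1 : 3 * (1 / 50) / √m + K / m ≤ 3 * (1 / 50) / √(2 * R) + K / (2 * R) := by gcongr
      have e2 : 2 * R * (3 * (1 / 50) / √(2 * R) + K / (2 * R)) = 3 / 50 * √(2 * R) + K := by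
        have : 2 * R / √(2 * R) = √(2 * R) := Real.div_sqrt
        calc _ = 3 / 50 * (2 * R / √(2 * R)) + K * (2 * R / (2 * R)) := by ring
          _ = _ := by rw [this, div_self (by positivity)]; ring
      rw [← e2]; gcongr
    have h3 : ((((Finset.range N).filter fun g => g ∈ G ∧ ¬ m ≤ g).card : ℕ) : ℝ) ≤
        countBelow G (2 * R) := by
      refine Nat.cast_le.2 (Finset.card_le_card fun g hg => ?_)
      simp only [Finset.mem_filter, Finset.mem_range] at hg ⊢
      exact ⟨not_le.1 hg.2.2, hg.2.1⟩
    have h4 := hlog (2 * R) (by linarith)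
    have h6 : 0 ≤ Real.log (2 * R) := Real.log_nonneg (by linarith)
    rw [nsmul_eq_mul]
    have h7 := mul_le_mul_of_nonneg_right h3 h6
    have h8 := mul_le_mul_of_nonneg_left h1 (show 0 ≤ 2 * R by linarith)
    have h9 := Real.sqrt_nonneg R
    have h5 : √(2 * R) ≤ 7 / 5 * √R + 1 / 50 * √R := by
      rw [Real.sqrt_mul zero_le_two]
      have : √2 ≤ 7 / 5 * 1 + 1 / 50 := by rw [Real.sqrt_le_iff]; norm_num
      nlinarith [Real.sqrt_nonneg R]
    linarith
  calc _ ≤ Real.exp (-∑ g ∈ (Finset.range N).filter (· ∈ G), F g) :=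
        Real.exp_le_exp.2 (neg_le_neg hsum)
    _ = ∏ g ∈ (Finset.range N).filter (· ∈ G), Real.exp (-F g) := by
        rw [← Finset.sum_neg_distrib, Real.exp_sum]
    _ ≤ ∏ g ∈ (Finset.range N).filter (· ∈ G), ‖1 - z / (g : ℂ)‖ :=
        Finset.prod_le_prod (fun _ _ => (Real.exp_pos _).le) hfac
    _ = _ := by rw [sparseProd, norm_prod]

theorem one_le_norm_sparseProd_of_le_norm {G : Set ℕ} (hG : 0 ∉ G) {z : ℂ} {N : ℕ}
    (hN : 2 * N ≤ ‖z‖) : 1 ≤ ‖sparseProd G N z‖ := by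
  classical
  rw [sparseProd, norm_prod]
  refine Finset.one_le_prod fun g hg => ?_
  rw [Finset.mem_filter, Finset.mem_range] at hg
  have hg0 : (0 : ℝ) < g := Nat.cast_pos.2 (Nat.pos_of_ne_zero fun h => hG (h ▸ hg.2))
  have hgN : (g : ℝ) ≤ N := Nat.cast_le.2 hg.1.le
  have h1 := norm_sub_norm_le (z / g) (1 : ℂ)
  rw [norm_one, norm_div, Complex.norm_natCast, norm_sub_rev] at h1
  have : 2 ≤ ‖z‖ / g := by rw [le_div_iff₀ hg0]; linarith
  linarith

theorem one_add_norm_le_mul_norm_add {z : ℂ} (hy : 1 ≤ z.im) (j : ℕ) :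
    1 + ‖z‖ ≤ (2 + j) * ‖z + j‖ := by
  have h1 : 1 ≤ ‖z + j‖ := by
    have := Complex.abs_im_le_norm (z + j)
    rw [Complex.add_im, Complex.natCast_im, add_zero] at this
    exact hy.trans ((le_abs_self _).trans this)
  have h2 := norm_sub_le (z + j) j
  rw [add_sub_cancel_right, Complex.norm_natCast] at h2
  have : (0 : ℝ) ≤ j := Nat.cast_nonneg j
  nlinarith

/-! ### Both products together on horizontal lines. -/

/-- The lower bound in the upper half-plane for the product of the two canonical products. -/
theorem min_exp_le_mul_norm {G : Set ℕ} (hG : 0 ∉ G) {K : ℝ} (hK : 0 ≤ K)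
    (hlog : ∀ x : ℝ, 1 ≤ x → countBelow G x * Real.log x ≤ 1 / 50 * √x + K)
    (hsqrt : ∀ x : ℝ, 1 ≤ x → countBelow G x ≤ 1 / 50 * √x + K)
    {z : ℂ} (hy : 1 ≤ z.im) {S : ℝ} (hS : 0 < S) {N M : ℕ} (hN : S ≤ N)
    (hNM : 2 * N ≤ M) (hyM : z.im ^ 2 ≤ M) :
    min (Real.exp (z.im / (5 * √S))) (Real.exp (countBelow G S / 5)) ≤
      25 * Real.exp (3 * K + 1) * ‖z‖ * ‖sparseProd G N z * squareProd M z‖ := by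
  have hyR : z.im ≤ ‖z‖ := (le_abs_self _).trans (Complex.abs_im_le_norm z)
  set R := ‖z‖ with hRdef
  have hR : 1 ≤ R := hy.trans hyR
  have hM1 : (1 : ℝ) ≤ M := le_trans (by nlinarith) hyM
  have hM1' : 1 ≤ M := by exact_mod_cast hM1
  have hNM' : 2 * (N : ℝ) ≤ M := by exact_mod_cast hNM
  have hK1 : 1 ≤ Real.exp (3 * K + 1) := Real.one_le_exp (by linarith)
  have hMM : (M : ℝ) ≤ M ^ 2 := by nlinarith
  have hcnt : (countBelow G S : ℝ) ≤ 1 / 50 * √S + K := by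
    rcases le_or_gt 1 S with h | h
    · exact hsqrt S h
    · rw [countBelow_of_le_one hG h.le, Nat.cast_zero]; positivity
  have hsR : R = √R * √R := (Real.mul_self_sqrt (by linarith)).symm
  have hsR1 : 1 ≤ √R := Real.one_le_sqrt.2 hR
  rw [norm_mul]
  set p := ‖sparseProd G N z‖
  set q := ‖squareProd M z‖
  rcases le_total z.re 0 with hx | hx
  · have hq1 : 1 ≤ 25 * R * q := by
      rcases le_total (-(2 * (M : ℝ) ^ 2)) z.re with h | h
      · refine le_trans (Real.one_le_exp (by positivity))
          (le_norm_squareProd_of_re_nonpos hx hy hM1' h hyM)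
      · have := one_le_norm_squareProd_of_re_le h
        nlinarith
    -- Inside radius `S` the sine bound for the square product supplies the first exponential;
    -- outside it the sparse product supplies the second.
    rcases le_total R S with hRS | hRS
    · have hp1 : 1 ≤ p := by
        have := le_norm_sparseProd_of_re_nonpos hG hx (S := 0) (norm_nonneg _)
          (Nat.cast_nonneg N)
        exact (Real.one_le_exp (by positivity)).trans this
      have h1 : -(2 * (M : ℝ) ^ 2) ≤ z.re := by
        have := (abs_le.1 (Complex.abs_re_le_norm z)).1
        linarith
      have h2 := le_norm_squareProd_of_re_nonpos hx hy hM1' h1 hyM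
      refine (min_le_left _ _).trans ?_
      calc Real.exp (z.im / (5 * √S)) ≤ Real.exp (z.im / (5 * √R)) := by
            refine Real.exp_le_exp.2 ?_
            gcongr
        _ ≤ 25 * R * q := h2
        _ ≤ (Real.exp (3 * K + 1) * p) * (25 * R * q) :=
            le_mul_of_one_le_left (by linarith) (one_le_mul_of_one_le_of_one_le hK1 hp1)
        _ = _ := by ring
    · have h1 := le_norm_sparseProd_of_re_nonpos hG hx hRS hN
      refine (min_le_right _ _).trans (h1.trans ?_)
      calc p ≤ (Real.exp (3 * K + 1) * (25 * R * q)) * p :=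
            le_mul_of_one_le_left (norm_nonneg _) (one_le_mul_of_one_le_of_one_le hK1 hq1)
        _ = _ := by ring
  · suffices h : min (Real.exp (z.im / (5 * √S))) (Real.exp (countBelow G S / 5)) ≤
        Real.exp (3 * K + 1) * (p * q) by
      have h0 : 0 ≤ p * q := by positivity
      calc _ ≤ _ := h
        _ ≤ (25 * R) * (Real.exp (3 * K + 1) * (p * q)) :=
            le_mul_of_one_le_left (by positivity) (by linarith)
        _ = _ := by ring
    -- On the right, up to `2N` the square product wins with net exponent `17/50 - 7/50 = 1/5`.
    -- Beyond `2N` the truncated sparse product is already at least `1`.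
    rcases le_total R (2 * N) with hRN | hRN
    · have h1 : Real.exp (-(7 / 50 * √R + 2 * K)) ≤ p := le_norm_sparseProd hG hK hlog hsqrt hy N
      have h2 := le_norm_squareProd_of_re_nonneg hx (M := M) (U := R) (by linarith) le_rfl
        (by linarith)
      have h3 : Real.exp (1 / 5 * √R) ≤ Real.exp (3 * K + 1) * (p * q) := by
        calc Real.exp (1 / 5 * √R) ≤ Real.exp (3 * K + 1) *
              (Real.exp (-(7 / 50 * √R + 2 * K)) * Real.exp (17 / 50 * (√R - 1))) := by
              rw [← Real.exp_add, ← Real.exp_add]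
              refine Real.exp_le_exp.2 ?_
              linarith
          _ ≤ _ := by gcongr
      rcases le_total R S with hRS | hRS
      · refine (min_le_left _ _).trans (le_trans (Real.exp_le_exp.2 ?_) h3)
        have : √R ≤ √S := Real.sqrt_le_sqrt hRS
        rw [div_le_iff₀ (by positivity)]
        nlinarith
      · have hSR : √S ≤ √R := Real.sqrt_le_sqrt hRS
        have h4 : (countBelow G S / 5 : ℝ) ≤ K / 5 + 1 / 5 * √R - 49 / 250 * √R := by linarith
        have h5 : Real.exp (countBelow G S / 5) ≤ Real.exp (3 * K + 1) * (p * q) := by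
          calc Real.exp (countBelow G S / 5) ≤ Real.exp (3 * K + 1) *
              (Real.exp (-(7 / 50 * √R + 2 * K)) * Real.exp (17 / 50 * (√R - 1))) := by
                rw [← Real.exp_add, ← Real.exp_add]
                refine Real.exp_le_exp.2 ?_
                linarith
            _ ≤ _ := by gcongr
        exact (min_le_right _ _).trans h5
    · have hp : 1 ≤ p := one_le_norm_sparseProd_of_le_norm hG hRN
      have hSR : S ≤ R := by
        have : (0 : ℝ) ≤ N := Nat.cast_nonneg N
        linarith
      have h2 := le_norm_squareProd_of_re_nonneg hx (M := M) (U := S) hS.le hSR (by linarith)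
      refine (min_le_right _ _).trans ?_
      have hs0 := Real.sqrt_nonneg S
      calc Real.exp (countBelow G S / 5) ≤ Real.exp (3 * K + 1) *
            (1 * Real.exp (17 / 50 * (√S - 1))) := by
            rw [one_mul, ← Real.exp_add]
            exact Real.exp_le_exp.2 (by linarith)
        _ ≤ _ := by gcongr

/-- Quadratic decay on horizontal lines of the reciprocal of the full product. -/
theorem norm_inv_mul_le {G : Set ℕ} (hG : 0 ∉ G) {K : ℝ} (hK : 0 ≤ K)
    (hlog : ∀ x : ℝ, 1 ≤ x → countBelow G x * Real.log x ≤ 1 / 50 * √x + K)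
    (hsqrt : ∀ x : ℝ, 1 ≤ x → countBelow G x ≤ 1 / 50 * √x + K)
    {z : ℂ} (hy : 1 ≤ z.im) {S : ℝ} (hS : 0 < S) {N M : ℕ} (hN : S ≤ N)
    (hNM : 2 * N ≤ M) (hyM : z.im ^ 2 ≤ M) :
    ‖(z * ((z + 2) * (z + 3) * (sparseProd G N z * squareProd M z)))⁻¹‖ ≤
      1000 * Real.exp (3 * K + 1) *
        max (Real.exp (-(z.im / (5 * √S)))) (Real.exp (-(countBelow G S / 5))) *
        (1 + z.re ^ 2)⁻¹ := by
  have h0 := one_add_norm_le_mul_norm_add hy 0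
  have h2 := one_add_norm_le_mul_norm_add hy 2
  have h3 := one_add_norm_le_mul_norm_add hy 3
  have hm := min_exp_le_mul_norm hG hK hlog hsqrt hy hS hN hNM hyM
  push_cast at h0 h2 h3
  rw [add_zero, add_zero] at h0
  have hre : z.re ^ 2 ≤ ‖z‖ ^ 2 := by rw [norm_sq_eq_re_im]; nlinarith
  have hn := norm_nonneg z
  -- Of the three factors `z`, `z + 2`, `z + 3`, one pays for the `‖z‖` lost in the lower bound and
  -- two give quadratic decay; `40 = 2 · 4 · 5`.
  have h4 : (1 + z.re ^ 2) * ‖z‖ ≤ 40 * (‖z‖ * (‖z + 2‖ * ‖z + 3‖)) := by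
    calc (1 + z.re ^ 2) * ‖z‖ ≤ (1 + ‖z‖) * ((1 + ‖z‖) * (1 + ‖z‖)) := by nlinarith
      _ ≤ (2 * ‖z‖) * (((2 + 2) * ‖z + 2‖) * ((2 + 3) * ‖z + 3‖)) := by gcongr
      _ = _ := by ring
  set m := min (Real.exp (z.im / (5 * √S))) (Real.exp (countBelow G S / 5)) with hmdef
  have hmpos : 0 < m := lt_min (Real.exp_pos _) (Real.exp_pos _)
  have hmax : max (Real.exp (-(z.im / (5 * √S)))) (Real.exp (-(countBelow G S / 5))) = m⁻¹ := by
    rw [hmdef, Real.exp_neg, Real.exp_neg]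
    rcases le_total (Real.exp (z.im / (5 * √S))) (Real.exp (countBelow G S / 5)) with h | h
    · rw [min_eq_left h, max_eq_left (inv_anti₀ (Real.exp_pos _) h)]
    · rw [min_eq_right h, max_eq_right (inv_anti₀ (Real.exp_pos _) h)]
  set w := ‖sparseProd G N z * squareProd M z‖ with hw
  have h5 : (1 + z.re ^ 2) * m ≤ 1000 * Real.exp (3 * K + 1) *
      ‖z * ((z + 2) * (z + 3) * (sparseProd G N z * squareProd M z))‖ := by
    rw [norm_mul, norm_mul, norm_mul, ← hw]
    have hw0 : 0 ≤ w := norm_nonneg _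
    calc (1 + z.re ^ 2) * m ≤ (1 + z.re ^ 2) * (25 * Real.exp (3 * K + 1) * ‖z‖ * w) := by gcongr
      _ = (25 * Real.exp (3 * K + 1) * w) * ((1 + z.re ^ 2) * ‖z‖) := by ring
      _ ≤ (25 * Real.exp (3 * K + 1) * w) * (40 * (‖z‖ * (‖z + 2‖ * ‖z + 3‖))) := by gcongr
      _ = _ := by ring
  rw [hmax, norm_inv, mul_assoc _ m⁻¹, ← mul_inv, ← div_eq_mul_inv]
  set D := ‖z * ((z + 2) * (z + 3) * (sparseProd G N z * squareProd M z))‖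
  have hpos : 0 < (1 + z.re ^ 2) * m := by positivity
  have hD : 0 < D := by
    by_contra hD
    have : D = 0 := le_antisymm (not_lt.1 hD) (norm_nonneg _)
    rw [this] at h5; linarith
  rw [inv_eq_one_div, div_le_div_iff₀ hD (by positivity)]
  linarith

/-! ### From the density hypothesis to the annihilating sums. -/

theorem ncard_eq_countBelow {G : Set ℕ} (hG : 0 ∉ G) (x : ℝ) :
    {g ∈ G | 0 < (g : ℝ) ∧ (g : ℝ) < x}.ncard = countBelow G x := by
  classical
  rw [countBelow, ← Set.ncard_coe_finset]
  congr 1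
  ext g
  simp only [Set.mem_ofPred_eq, Finset.coe_filter, Finset.mem_range, Nat.lt_ceil]
  constructor
  · rintro ⟨h1, -, h2⟩; exact ⟨h2, h1⟩
  · rintro ⟨h1, h2⟩
    exact ⟨h2, Nat.cast_pos.2 (Nat.pos_of_ne_zero fun h => hG (h ▸ h2)), h1⟩

/-- Eventually `1 + r x ≤ 2`, which turns `1/100` into `1/50`, and `log x ≥ 1` makes the second
bound follow from the first. The constant `K` absorbs the range below the threshold. -/
theorem exists_countBelow_bounds {G : Set ℕ} (hG : 0 ∉ G) {r : ℝ → ℝ}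
    (hr : Tendsto r atTop (nhds 0))
    (h : ∀ᶠ x : ℝ in atTop, (({g ∈ G | 0 < (g : ℝ) ∧ (g : ℝ) < x}.ncard : ℕ) : ℝ)
      ≤ 1 / 100 * (Real.sqrt x / Real.log x) * (1 + r x)) :
    ∃ K : ℝ, 0 ≤ K ∧ (∀ x : ℝ, 1 ≤ x → countBelow G x * Real.log x ≤ 1 / 50 * √x + K) ∧
      ∀ x : ℝ, 1 ≤ x → countBelow G x ≤ 1 / 50 * √x + K := by
  obtain ⟨x₀, hx₀⟩ := eventually_atTop.1
    ((h.and (hr.eventually_le_const zero_lt_one)).and (eventually_ge_atTop (Real.exp 1)))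
  have he : 1 ≤ Real.log x₀ := by
    rw [Real.le_log_iff_exp_le (lt_of_lt_of_le (Real.exp_pos 1) (hx₀ x₀ le_rfl).2)]
    exact (hx₀ x₀ le_rfl).2
  have hbig : ∀ x, x₀ ≤ x → countBelow G x * Real.log x ≤ 1 / 50 * √x ∧ 1 ≤ Real.log x := by
    intro x hx
    obtain ⟨⟨h1, h2⟩, h3⟩ := hx₀ x hx
    have hx0 : 0 < x := lt_of_lt_of_le (Real.exp_pos 1) h3
    have hl : 1 ≤ Real.log x := (Real.le_log_iff_exp_le hx0).2 h3
    refine ⟨?_, hl⟩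
    rw [ncard_eq_countBelow hG] at h1
    have h4 : 1 / 100 * (√x / Real.log x) * (1 + r x) ≤ 1 / 50 * (√x / Real.log x) := by
      have : 0 ≤ √x / Real.log x := by positivity
      nlinarith
    calc countBelow G x * Real.log x ≤ 1 / 50 * (√x / Real.log x) * Real.log x := by
          gcongr; exact h1.trans h4
      _ = 1 / 50 * √x := by field_simp
  have hc0 : (0 : ℝ) ≤ countBelow G x₀ := Nat.cast_nonneg _
  refine ⟨countBelow G x₀ * Real.log x₀, by positivity, fun x hx => ?_, fun x hx => ?_⟩
  · rcases le_total x₀ x with hxx | hxx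
    · have := (hbig x hxx).1
      nlinarith
    · have h1 : (countBelow G x : ℝ) ≤ countBelow G x₀ := Nat.cast_le.2 (countBelow_mono G hxx)
      have h2 : Real.log x ≤ Real.log x₀ := Real.log_le_log (by linarith) hxx
      have h3 := mul_le_mul h1 h2 (Real.log_nonneg hx) hc0
      have := Real.sqrt_nonneg x
      linarith
  · have hs := Real.sqrt_nonneg x
    have hcx : (0 : ℝ) ≤ countBelow G x := Nat.cast_nonneg _
    rcases le_total x₀ x with hxx | hxx
    · have := hbig x hxx
      nlinarith
    · have h1 : (countBelow G x : ℝ) ≤ countBelow G x₀ := Nat.cast_le.2 (countBelow_mono G hxx)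
      nlinarith

theorem exists_expSum_sequence {G : Set ℕ} (hG : 0 ∉ G) {K : ℝ} (hK : 0 ≤ K)
    (hlog : ∀ x : ℝ, 1 ≤ x → countBelow G x * Real.log x ≤ 1 / 50 * √x + K)
    (hsqrt : ∀ x : ℝ, 1 ≤ x → countBelow G x ≤ 1 / 50 * √x + K) (N : ℕ) :
    ∃ f : ℝ → ℂ, Continuous f ∧
      (∀ n : ℕ, 1 ≤ n → n ∉ G → ∫ t in Set.Ioo (0 : ℝ) 1, f t * expo n t = 0) ∧
      (∫ t in Set.Ioo (0 : ℝ) 1, f t = 1 / 6) ∧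
      ∀ y S t : ℝ, 1 ≤ y → y ≤ N → 0 < S → S ≤ N → 0 < t →
        ‖f t‖ ≤ 1000 * Real.exp (3 * K + 1) *
          max (Real.exp (-(y / (5 * √S)))) (Real.exp (-(countBelow G S / 5))) *
          Real.exp (2 * Real.pi * y * t) := by
  classical
  -- Large enough for both `2N ≤ M` and `y² ≤ M` whenever `y ≤ N`.
  set M := N ^ 2 + 2 * N with hM
  set A := ((Finset.range N).filter (· ∈ G)).image (fun g : ℕ => (g : ℤ)) with hA
  set B := (Finset.range M).image (fun k : ℕ => -((k : ℤ) + 1) ^ 2) with hB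
  have hApos : ∀ p ∈ A, 0 < p ∧ p.toNat ∈ G := by
    intro p hp
    obtain ⟨g, hg, rfl⟩ := Finset.mem_image.1 hp
    have hgG := (Finset.mem_filter.1 hg).2
    refine ⟨Int.natCast_pos.2 (Nat.pos_of_ne_zero fun h => hG (h ▸ hgG)), by simpa using hgG⟩
  -- The extra zeros `-2` and `-3` are not negatives of squares, so all zeros stay simple.
  have hBneg : ∀ p ∈ B, p < 0 ∧ p ≠ -2 ∧ p ≠ -3 := by
    intro p hp
    obtain ⟨k, -, rfl⟩ := Finset.mem_image.1 hp
    have hk : (0 : ℤ) ≤ k := Int.natCast_nonneg k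
    refine ⟨by nlinarith, fun h => ?_, fun h => ?_⟩ <;>
    · rcases Nat.lt_or_ge k 1 with h1 | h1
      · interval_cases k; simp at h
      · have : (1 : ℤ) ≤ k := by exact_mod_cast h1
        nlinarith
  have hAB : Disjoint A B := Finset.disjoint_left.2 fun p h1 h2 =>
    absurd (hApos p h1).1 (not_lt.2 (hBneg p h2).1.le)
  have h3 : (-3 : ℤ) ∉ A ∪ B := fun h => (Finset.mem_union.1 h).elim
    (fun h => absurd (hApos _ h).1 (by norm_num)) (fun h => (hBneg _ h).2.2 rfl)
  have h2 : (-2 : ℤ) ∉ insert (-3) (A ∪ B) := fun h => (Finset.mem_insert.1 h).elim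
    (by norm_num) fun h => (Finset.mem_union.1 h).elim
    (fun h => absurd (hApos _ h).1 (by norm_num)) (fun h => (hBneg _ h).2.1 rfl)
  have h0 : (0 : ℤ) ∉ insert (-2) (insert (-3) (A ∪ B)) := fun h =>
    (Finset.mem_insert.1 h).elim (by norm_num) fun h => (Finset.mem_insert.1 h).elim
    (by norm_num) fun h => (Finset.mem_union.1 h).elim
    (fun h => absurd (hApos _ h).1 (by norm_num)) (fun h => absurd (hBneg _ h).1 (by norm_num))
  set κ : ℂ := (∏ g ∈ (Finset.range N).filter (· ∈ G), (-(g : ℂ)⁻¹)) *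
    ∏ k ∈ Finset.range M, (((k : ℂ) + 1) ^ 2)⁻¹ with hκ
  have hE : ∀ z : ℂ, (z + 2) * (z + 3) * (sparseProd G N z * squareProd M z) =
      κ * ∏ p ∈ insert (-2) (insert (-3) (A ∪ B)), (z - p) := by
    intro z
    have e1 : sparseProd G N z = (∏ g ∈ (Finset.range N).filter (· ∈ G), (-(g : ℂ)⁻¹)) *
        ∏ p ∈ A, (z - p) := by
      rw [hA, Finset.prod_image Nat.cast_injective.injOn, ← Finset.prod_mul_distrib, sparseProd]
      refine Finset.prod_congr rfl fun g hg => ?_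
      have hg0 : (g : ℂ) ≠ 0 := Nat.cast_ne_zero.2 fun h => hG (h ▸ (Finset.mem_filter.1 hg).2)
      push_cast; field_simp; ring
    have e2 : squareProd M z = (∏ k ∈ Finset.range M, (((k : ℂ) + 1) ^ 2)⁻¹) *
        ∏ p ∈ B, (z - p) := by
      rw [hB, Finset.prod_image, ← Finset.prod_mul_distrib, squareProd]
      · refine Finset.prod_congr rfl fun k _ => ?_
        have hk0 : (k : ℂ) + 1 ≠ 0 := Nat.cast_add_one_ne_zero k
        push_cast; field_simp; ring
      · intro a _ b _ hab
        have ha : (0 : ℤ) ≤ a := Int.natCast_nonneg a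
        have hb : (0 : ℤ) ≤ b := Int.natCast_nonneg b
        have : ((a : ℤ) + 1) ^ 2 = ((b : ℤ) + 1) ^ 2 := neg_injective hab
        have := (pow_left_inj₀ (by linarith) (by linarith) two_ne_zero).1 this
        omega
    rw [Finset.prod_insert h2, Finset.prod_insert h3, Finset.prod_union hAB, e1, e2, hκ]
    push_cast; ring
  obtain ⟨f, hf, hf1, hf2, hf3⟩ := exists_expSum_of_simple_zeros _ h0 κ _ hE
  refine ⟨f, hf, fun n hn hnG => ?_, ?_, fun y S t hy hyN hS hSN ht => ?_⟩
  · have := hf1 (n : ℤ) ?_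
    · simpa using this
    · intro h
      simp only [Finset.mem_insert, Finset.mem_union] at h
      rcases h with h | h | h | h | h
      · omega
      · omega
      · omega
      · exact hnG (by simpa using (hApos _ h).2)
      · have := (hBneg _ h).1; omega
  · rw [hf2]
    norm_num [sparseProd, squareProd]
  · refine hf3 y _ (by linarith) (fun x => ?_) t ht
    have him : ((x : ℂ) + y * Complex.I).im = y := by simp
    have hre : ((x : ℂ) + y * Complex.I).re = x := by simp
    have := norm_inv_mul_le hG hK hlog hsqrt (z := x + y * Complex.I) (by rwa [him]) hS hSN
      (M := M) (by rw [hM]; exact Nat.le_add_left _ _) (by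
        rw [him, hM]; push_cast
        have : y ^ 2 ≤ (N : ℝ) ^ 2 := pow_le_pow_left₀ (by linarith) hyN 2
        have : (0 : ℝ) ≤ N := Nat.cast_nonneg N
        linarith)
    rwa [him, hre] at this

/-! ### The weight and its logarithmic integral. -/

/-- The counting function of `G` in the variable `1 / (20 π t) ^ 2`. -/
noncomputable def countInv (G : Set ℕ) (t : ℝ) : ℝ := countBelow G (1 / (20 * Real.pi * t) ^ 2)

/-- The weight with a deep zero attached to `G`. -/
noncomputable def deepWeight (G : Set ℕ) (t : ℝ) : ℝ := (1 + t) * Real.exp (-(countInv G t / 5))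

theorem countInv_nonneg (G : Set ℕ) (t : ℝ) : 0 ≤ countInv G t := Nat.cast_nonneg _

theorem measurable_countInv (G : Set ℕ) : Measurable (countInv G) := by
  classical
  have h1 : Measurable fun n : ℕ => ((((Finset.range n).filter (· ∈ G)).card : ℕ) : ℝ) :=
    measurable_from_nat
  have h2 : Measurable fun t : ℝ => ⌈1 / (20 * Real.pi * t) ^ 2⌉₊ :=
    Nat.measurable_ceil.comp (by fun_prop)
  have := h1.comp h2
  convert this using 1
  ext t
  simp only [countInv, countBelow, Function.comp_def]

theorem measurable_deepWeight (G : Set ℕ) : Measurable (deepWeight G) := by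
  have := measurable_countInv G
  unfold deepWeight
  fun_prop

theorem norm_le_of_parameters {G : Set ℕ} {N : ℕ} {f : ℝ → ℂ} {C : ℝ} (hC : 0 ≤ C)
    (hf : ∀ y S t : ℝ, 1 ≤ y → y ≤ N → 0 < S → S ≤ N → 0 < t →
        ‖f t‖ ≤ C * max (Real.exp (-(y / (5 * √S)))) (Real.exp (-(countBelow G S / 5))) *
          Real.exp (2 * Real.pi * y * t))
    {t : ℝ} (ht : t ∈ Set.Ioo (0 : ℝ) 1) (h1 : 1 + countInv G t / (20 * Real.pi * t) ≤ N)
    (h2 : 1 / (20 * Real.pi * t) ^ 2 ≤ N) :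
    ‖f t‖ ≤ C * Real.exp (2 * Real.pi) * Real.exp (-(countInv G t / 10)) := by
  have hpi := Real.pi_pos
  have ht0 := ht.1
  have hc := countInv_nonneg G t
  -- With `√S = 1/(20πt)`, the decay exponent `y/(5√S)` equals `4πyt`, twice the growth exponent
  -- `2πyt`. The latter is `2πt + countInv G t / 10`, so both terms of the maximum leave
  -- `e^{-countInv/10}`. The summand `1` ensures `y ≥ 1`.
  set y := 1 + countInv G t / (20 * Real.pi * t) with hy
  have h3 := hf y (1 / (20 * Real.pi * t) ^ 2) t (by rw [hy]; linarith [show 0 ≤ countInv G t / (20 * Real.pi * t) by positivity]) h1 (by positivity) h2 ht0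
  have e1 : √(1 / (20 * Real.pi * t) ^ 2) = 1 / (20 * Real.pi * t) := by
    rw [← one_div_pow, Real.sqrt_sq (by positivity)]
  have e2 : y / (5 * (1 / (20 * Real.pi * t))) = 4 * Real.pi * y * t := by
    field_simp; ring
  have e3 : 2 * Real.pi * y * t = 2 * Real.pi * t + countInv G t / 10 := by
    rw [hy]; field_simp; ring
  have e4 : 2 * Real.pi * t ≤ 2 * Real.pi := by nlinarith [ht.2]
  have e5 : 0 ≤ 2 * Real.pi * t := by positivity
  rw [e1, e2] at h3
  refine h3.trans ?_
  rw [mul_assoc C, mul_assoc C]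
  refine mul_le_mul_of_nonneg_left ?_ hC
  rw [max_mul_of_nonneg _ _ (Real.exp_pos _).le, ← Real.exp_add, ← Real.exp_add, ← Real.exp_add]
  refine max_le (Real.exp_le_exp.2 ?_) (Real.exp_le_exp.2 ?_)
  · have : 4 * Real.pi * y * t = 2 * (2 * Real.pi * y * t) := by ring
    rw [this, e3]; linarith
  · rw [e3]
    change -(countInv G t / 5) + _ ≤ _
    linarith

/-- Layer cake: `g < (20πt)⁻²` exactly when `t < 1/(20π√g)`, so each `g` contributes an interval of
that length. -/
theorem lintegral_countInv_eq_top {G : Set ℕ} (hG : 0 ∉ G)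
    (hsum : ¬ Summable fun g : G => 1 / √((g : ℕ) : ℝ)) :
    ∫⁻ t in Set.Ioo (0 : ℝ) 1, ENNReal.ofReal (countInv G t) = ⊤ := by
  classical
  by_contra htop
  refine hsum ?_
  have hpi := Real.pi_gt_three
  set I := ∫⁻ t in Set.Ioo (0 : ℝ) 1, ENNReal.ofReal (countInv G t) with hI
  refine summable_of_sum_le (c := 20 * Real.pi * I.toReal) (fun g => by positivity) fun F => ?_
  set a : G → ℝ := fun g => 1 / (20 * Real.pi * √((g : ℕ) : ℝ)) with ha
  have hg1 : ∀ g : G, 1 ≤ √((g : ℕ) : ℝ) := fun g => Real.one_le_sqrt.2 (by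
    exact_mod_cast Nat.one_le_iff_ne_zero.2 fun h => hG (h ▸ g.2))
  have ha0 : ∀ g, 0 < a g := fun g => by have := hg1 g; positivity
  have ha1 : ∀ g, a g ≤ 1 := fun g => by
    have := hg1 g
    rw [ha, div_le_one (by positivity)]; nlinarith
  have hpt : ∀ t ∈ Set.Ioo (0 : ℝ) 1,
      ∑ g ∈ F, (Set.Ioo 0 (a g)).indicator (fun _ => (1 : ENNReal)) t ≤
        ENNReal.ofReal (countInv G t) := by
    intro t ht
    simp only [Set.indicator_apply]
    rw [Finset.sum_boole, countInv, ENNReal.ofReal_natCast]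
    refine Nat.cast_le.2 ?_
    rw [countBelow, ← Finset.card_map (Function.Embedding.subtype (· ∈ G))]
    refine Finset.card_le_card fun n hn => ?_
    obtain ⟨g, hg, rfl⟩ := Finset.mem_map.1 hn
    rw [Finset.mem_filter, Finset.mem_range, Nat.lt_ceil]
    refine ⟨?_, g.2⟩
    have h1 := (Finset.mem_filter.1 hg).2.2
    have h2 := hg1 g
    have ht0 := ht.1
    rw [ha, lt_div_iff₀ (by positivity)] at h1
    rw [Function.Embedding.subtype_apply, lt_div_iff₀ (by positivity)]
    have h3 : (20 * Real.pi * t * √((g : ℕ) : ℝ)) ^ 2 < 1 := by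
      have : 0 ≤ 20 * Real.pi * t * √((g : ℕ) : ℝ) := by positivity
      nlinarith
    rw [mul_pow, Real.sq_sqrt (Nat.cast_nonneg _)] at h3
    linarith
  have h1 : ∑ g ∈ F, ENNReal.ofReal (a g) ≤ I := by
    calc ∑ g ∈ F, ENNReal.ofReal (a g) =
          ∫⁻ t in Set.Ioo (0 : ℝ) 1,
            ∑ g ∈ F, (Set.Ioo 0 (a g)).indicator (fun _ => (1 : ENNReal)) t := by
          rw [lintegral_finsetSum _ fun g _ => measurable_const.indicator measurableSet_Ioo]
          refine Finset.sum_congr rfl fun g _ => ?_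
          rw [lintegral_indicator measurableSet_Ioo, Measure.restrict_restrict measurableSet_Ioo,
            Set.inter_eq_left.2 (Set.Ioo_subset_Ioo_right (ha1 g)), lintegral_one,
            Measure.restrict_apply_univ, Real.volume_Ioo, sub_zero]
      _ ≤ I := setLIntegral_mono (measurable_countInv G).ennreal_ofReal hpt
  rw [← ENNReal.ofReal_sum_of_nonneg fun g _ => (ha0 g).le] at h1
  have h2 := (ENNReal.ofReal_le_iff_le_toReal htop).1 h1
  calc ∑ g ∈ F, 1 / √((g : ℕ) : ℝ) = 20 * Real.pi * ∑ g ∈ F, a g := by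
        rw [Finset.mul_sum]
        refine Finset.sum_congr rfl fun g _ => ?_
        have := hg1 g
        rw [ha]; field_simp
    _ ≤ _ := by gcongr

theorem deepZeroWeight_deepWeight {G : Set ℕ} (hG : 0 ∉ G)
    (hsum : ¬ Summable fun g : G => 1 / √((g : ℕ) : ℝ)) : DeepZeroWeight (deepWeight G) := by
  have hlogw : ∀ t ∈ Set.Ioo (0 : ℝ) 1,
      Real.log (deepWeight G t) = Real.log (1 + t) - countInv G t / 5 := by
    intro t ht
    rw [deepWeight, Real.log_mul (by linarith [ht.1]) (Real.exp_pos _).ne', Real.log_exp]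
    ring
  have hlog1 : ∀ t ∈ Set.Ioo (0 : ℝ) 1, Real.log (1 + t) ≤ 1 := by
    intro t ht
    have := Real.log_le_sub_one_of_pos (show 0 < 1 + t by linarith [ht.1])
    linarith [ht.2]
  refine ⟨fun t ht => ?_, fun s hs t ht hst => ?_, ⟨2, fun t ht => ?_⟩, ?_, ?_⟩
  · have := ht.1
    unfold deepWeight; positivity
  · have hs0 := hs.1
    have hpi := Real.pi_pos
    have h1 : countInv G t ≤ countInv G s := by
      refine Nat.cast_le.2 (countBelow_mono G ?_)
      gcongr
    -- The exponential is a step function; the factor `1 + t` makes the monotonicity strict.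
    unfold deepWeight
    have h2 : Real.exp (-(countInv G s / 5)) ≤ Real.exp (-(countInv G t / 5)) :=
      Real.exp_le_exp.2 (by linarith)
    have := Real.exp_pos (-(countInv G s / 5))
    nlinarith
  · have h1 : Real.exp (-(countInv G t / 5)) ≤ 1 := by
      rw [Real.exp_le_one_iff]; linarith [countInv_nonneg G t]
    have := Real.exp_pos (-(countInv G t / 5))
    unfold deepWeight
    nlinarith [ht.1, ht.2]
  · calc (∫⁻ t in Set.Ioo (0 : ℝ) 1, ENNReal.ofReal (Real.log (deepWeight G t)))
        ≤ ∫⁻ _ in Set.Ioo (0 : ℝ) 1, 1 := by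
          refine setLIntegral_mono measurable_const fun t ht => ?_
          rw [← ENNReal.ofReal_one]
          refine ENNReal.ofReal_le_ofReal ?_
          rw [hlogw t ht]
          linarith [hlog1 t ht, countInv_nonneg G t]
      _ < ⊤ := by simp
  · have h1 : ∫⁻ t in Set.Ioo (0 : ℝ) 1, ENNReal.ofReal (countInv G t) ≤
        ∫⁻ t in Set.Ioo (0 : ℝ) 1, (5 * ENNReal.ofReal (-Real.log (deepWeight G t)) + 5) := by
      have hm := (measurable_deepWeight G).log
      refine setLIntegral_mono (by fun_prop) fun t ht => ?_
      have : countInv G t ≤ 5 * (-Real.log (deepWeight G t)) + 5 := by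
        rw [hlogw t ht]; linarith [hlog1 t ht]
      refine (ENNReal.ofReal_le_ofReal this).trans (ENNReal.ofReal_add_le.trans ?_)
      rw [ENNReal.ofReal_mul (by norm_num)]
      norm_num
    rw [lintegral_countInv_eq_top hG hsum, top_le_iff, lintegral_add_right _ measurable_const,
      lintegral_const_mul' _ _ (by norm_num)] at h1
    by_contra hne
    refine absurd h1 (ENNReal.add_ne_top.2 ⟨ENNReal.mul_ne_top (by norm_num) hne, ?_⟩)
    simp

theorem sq_exp_countInv_le_deepWeight {G : Set ℕ} {t : ℝ} (ht : 0 < t) :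
    Real.exp (-(countInv G t / 10)) ^ 2 ≤ deepWeight G t := by
  rw [← Real.exp_nat_mul, deepWeight]
  have e : ((2 : ℕ) : ℝ) * -(countInv G t / 10) = -(countInv G t / 5) := by push_cast; ring
  rw [e]
  have := Real.exp_pos (-(countInv G t / 5))
  nlinarith

/-! ### A duality criterion for noncompleteness. -/

theorem integral_weightedMeasure {w : ℝ → ℝ} (hw : Measurable w)
    (hpos : ∀ t ∈ Set.Ioo (0 : ℝ) 1, 0 < w t) (g : ℝ → ℝ) :
    ∫ t, g t ∂weightedMeasure w = ∫ t in Set.Ioo (0 : ℝ) 1, w t * g t := by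
  rw [weightedMeasure, integral_withDensity_eq_integral_toReal_smul hw.ennreal_ofReal
    (Eventually.of_forall fun _ => ENNReal.ofReal_lt_top)]
  refine setIntegral_congr_fun measurableSet_Ioo fun t ht => ?_
  simp [ENNReal.toReal_ofReal (hpos t ht).le]

/-- A sequence of functions orthogonal to a family, dominated in the limit by the square root of
the weight and with integral bounded away from zero, prevents completeness of the family. -/
theorem not_isCompleteFamily_of_sequence {Λ : Set ℝ} {w m : ℝ → ℝ} (hw : Measurable w)
    (hpos : ∀ t ∈ Set.Ioo (0 : ℝ) 1, 0 < w t) {B : ℝ} (hB : ∀ t ∈ Set.Ioo (0 : ℝ) 1, w t ≤ B)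
    {f : ℕ → ℝ → ℂ} (hf : ∀ N, Continuous (f N)) {δ L : ℝ} (hδ : 0 < δ)
    (horth : ∀ a ∈ Λ, ∀ N, ∫ t in Set.Ioo (0 : ℝ) 1, f N t * expo a t = 0)
    (hint : ∀ N, δ ≤ ‖∫ t in Set.Ioo (0 : ℝ) 1, f N t‖)
    (hL : ∀ N, ∀ t ∈ Set.Ioo (0 : ℝ) 1, ‖f N t‖ ≤ L)
    (hm : Measurable m) (hm0 : ∀ t, 0 ≤ m t) (hmL : ∀ t, m t ≤ L)
    (hmw : ∃ C, ∀ t ∈ Set.Ioo (0 : ℝ) 1, m t ^ 2 ≤ C * w t)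
    (hlim : ∀ t ∈ Set.Ioo (0 : ℝ) 1, ∀ᶠ N in atTop, ‖f N t‖ ≤ m t) :
    ¬ IsCompleteFamily Λ w := by
  intro hcomp
  obtain ⟨C, hC⟩ := hmw
  set ν := volume.restrict (Set.Ioo (0 : ℝ) 1) with hν
  have hcontInt : ∀ {g : ℝ → ℂ}, Continuous g → Integrable g ν := fun hg =>
    (hg.integrableOn_Icc (a := 0) (b := 1)).mono_set Set.Ioo_subset_Icc_self
  have hcontInt' : ∀ {g : ℝ → ℝ}, Continuous g → Integrable g ν := fun hg =>
    (hg.integrableOn_Icc (a := 0) (b := 1)).mono_set Set.Ioo_subset_Icc_self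
  have hmem : ∀ᵐ t ∂ν, t ∈ Set.Ioo (0 : ℝ) 1 := ae_restrict_mem measurableSet_Ioo
  have : IsFiniteMeasure (weightedMeasure w) := by
    refine isFiniteMeasure_withDensity (ne_of_lt ?_)
    calc ∫⁻ t, ENNReal.ofReal (w t) ∂ν ≤ ∫⁻ _, ENNReal.ofReal B ∂ν :=
          lintegral_mono_ae (hmem.mono fun t ht => ENNReal.ofReal_le_ofReal (hB t ht))
      _ < ⊤ := by simp [hν]
  have hspan : ∀ q ∈ Submodule.span ℂ (expFamily Λ w), ∃ Q : ℝ → ℂ, Continuous Q ∧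
      ⇑q =ᵐ[weightedMeasure w] Q ∧ ∀ N, ∫ t, f N t * Q t ∂ν = 0 := by
    intro q hq
    induction hq using Submodule.span_induction with
    | mem q hq =>
      obtain ⟨a, ha, hqa⟩ := hq
      exact ⟨expo a, continuous_expo a, hqa, horth a ha⟩
    | zero => exact ⟨0, continuous_zero, Lp.coeFn_zero _ _ _, by simp⟩
    | add p q _ _ hp hq =>
      obtain ⟨P, hP, hpP, hP0⟩ := hp
      obtain ⟨Q, hQ, hqQ, hQ0⟩ := hq
      refine ⟨P + Q, hP.add hQ, (Lp.coeFn_add p q).trans (hpP.add hqQ), fun N => ?_⟩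
      simp only [Pi.add_apply, mul_add]
      rw [integral_add (hcontInt (g := fun t => f N t * P t) ((hf N).mul hP)) (hcontInt (g := fun t => f N t * Q t) ((hf N).mul hQ)), hP0, hQ0, add_zero]
    | smul c q _ hq =>
      obtain ⟨Q, hQ, hqQ, hQ0⟩ := hq
      refine ⟨c • Q, hQ.const_smul c, (Lp.coeFn_smul c q).trans (hqQ.const_smul c), fun N => ?_⟩
      simp only [Pi.smul_apply, smul_eq_mul, mul_left_comm _ c]
      rw [integral_const_mul, hQ0, mul_zero]
  have hdist : ∀ Q : ℝ → ℂ, Continuous Q → (∀ N, ∫ t, f N t * Q t ∂ν = 0) →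
      δ ≤ ∫ t, m t * ‖1 - Q t‖ ∂ν := by
    intro Q hQ hQ0
    have hdom : Continuous fun t => L * ‖1 - Q t‖ := by fun_prop
    have hnormQ : Continuous fun t => ‖1 - Q t‖ := by fun_prop
    -- The bound by `m` holds only from some `N` depending on `t`. Taking the maximum with `m` makes
    -- the integrand eventually constant at each `t`, and `L` provides the domination.
    have htend : Tendsto (fun N => ∫ t, max ‖f N t‖ (m t) * ‖1 - Q t‖ ∂ν) atTop
        (nhds (∫ t, m t * ‖1 - Q t‖ ∂ν)) := by
      refine tendsto_integral_of_dominated_convergence (fun t => L * ‖1 - Q t‖)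
        (fun N => ?_) (hcontInt' hdom) (fun N => ?_) ?_
      · exact (((hf N).norm.measurable.max hm).mul hnormQ.measurable).aestronglyMeasurable
      · filter_upwards [hmem] with t ht
        rw [Real.norm_of_nonneg (mul_nonneg ((hm0 t).trans (le_max_right _ _)) (norm_nonneg _))]
        exact mul_le_mul_of_nonneg_right (max_le (hL N t ht) (hmL t)) (norm_nonneg _)
      · filter_upwards [hmem] with t ht
        refine tendsto_const_nhds.congr' ?_
        filter_upwards [hlim t ht] with N hN
        rw [max_eq_right hN]
    refine ge_of_tendsto' htend fun N => ?_
    have h1 : ∫ t, f N t ∂ν = ∫ t, f N t * (1 - Q t) ∂ν := by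
      simp only [mul_sub, mul_one]
      rw [integral_sub (hcontInt (hf N)) (hcontInt (g := fun t => f N t * Q t) ((hf N).mul hQ)), hQ0, sub_zero]
    refine (hint N).trans ?_
    rw [h1]
    refine norm_integral_le_of_norm_le ?_ (Eventually.of_forall fun t => ?_)
    · refine (hcontInt' hdom).mono' ?_ ?_
      · exact (((hf N).norm.measurable.max hm).mul hnormQ.measurable).aestronglyMeasurable
      · filter_upwards [hmem] with t ht
        rw [Real.norm_of_nonneg (mul_nonneg ((hm0 t).trans (le_max_right _ _)) (norm_nonneg _))]
        exact mul_le_mul_of_nonneg_right (max_le (hL N t ht) (hmL t)) (norm_nonneg _)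
    · rw [norm_mul]
      exact mul_le_mul_of_nonneg_right (le_max_left _ _) (norm_nonneg _)
  have hone : MemLp (fun _ : ℝ => (1 : ℂ)) 2 (weightedMeasure w) := memLp_const 1
  have hcl : hone.toLp _ ∈ closure (Submodule.span ℂ (expFamily Λ w) : Set _) := by
    rw [← Submodule.topologicalClosure_coe, hcomp]; trivial
  have key : ∀ ε : ℝ, 0 < ε → δ ^ 2 ≤ |C| * ε ^ 2 := by
    intro ε hε
    obtain ⟨q, hq, hqε⟩ := Metric.mem_closure_iff.1 hcl ε hε
    obtain ⟨Q, hQ, hqQ, hQ0⟩ := hspan q hq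
    have hnormQ : Continuous fun t => ‖1 - Q t‖ := by fun_prop
    have h1 := hdist Q hQ hQ0
    have hnorm : ∫ t, w t * ‖1 - Q t‖ ^ 2 ∂ν ≤ ε ^ 2 := by
      rw [hν, ← integral_weightedMeasure hw hpos]
      have h2 : ((‖hone.toLp _ - q‖ ^ 2 : ℝ) : ℂ) =
          ((∫ t, ‖1 - Q t‖ ^ 2 ∂weightedMeasure w : ℝ) : ℂ) := by
        have h3 := inner_self_eq_norm_sq_to_K (𝕜 := ℂ) (hone.toLp _ - q)
        rw [L2.inner_def] at h3
        rw [← integral_complex_ofReal]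
        push_cast
        refine h3.symm.trans (integral_congr_ae ?_)
        filter_upwards [Lp.coeFn_sub (hone.toLp _) q, hone.coeFn_toLp, hqQ] with t e1 e2 e3
        rw [inner_self_eq_norm_sq_to_K, e1, Pi.sub_apply, e2, e3]
        simp
      have h4 := Complex.ofReal_injective h2
      rw [← h4]
      rw [dist_eq_norm] at hqε
      exact pow_le_pow_left₀ (norm_nonneg _) hqε.le 2
    have hI1 : Integrable (fun t => w t * ‖1 - Q t‖ ^ 2) ν := by
      have hdom : Continuous fun t => B * ‖1 - Q t‖ ^ 2 := by fun_prop
      refine (hcontInt' hdom).mono' (hw.mul (hnormQ.measurable.pow_const 2)).aestronglyMeasurable ?_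
      filter_upwards [hmem] with t ht
      rw [Real.norm_of_nonneg (mul_nonneg (hpos t ht).le (by positivity))]
      exact mul_le_mul_of_nonneg_right (hB t ht) (by positivity)
    -- Cauchy–Schwarz in the form `ab ≤ δ/2 + (ab)²/(2δ)`, so the term `δ/2` can be absorbed by the
    -- lower bound `δ`.
    have hle : ∫ t, m t * ‖1 - Q t‖ ∂ν ≤
        ∫ t, (δ / 2 + |C| / (2 * δ) * (w t * ‖1 - Q t‖ ^ 2)) ∂ν := by
      refine integral_mono_of_nonneg ?_ ((integrable_const _).add (hI1.const_mul _)) ?_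
      · exact Eventually.of_forall fun t => mul_nonneg (hm0 t) (norm_nonneg _)
      · filter_upwards [hmem] with t ht
        have h5 : m t ^ 2 ≤ |C| * w t :=
          (hC t ht).trans (mul_le_mul_of_nonneg_right (le_abs_self C) (hpos t ht).le)
        have h6 : (m t * ‖1 - Q t‖) ^ 2 ≤ |C| * (w t * ‖1 - Q t‖ ^ 2) := by
          rw [mul_pow, ← mul_assoc]
          exact mul_le_mul_of_nonneg_right h5 (by positivity)
        have h7 : δ / 2 + |C| / (2 * δ) * (w t * ‖1 - Q t‖ ^ 2) =
            (δ ^ 2 + |C| * (w t * ‖1 - Q t‖ ^ 2)) / (2 * δ) := by field_simp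
        change m t * ‖1 - Q t‖ ≤ δ / 2 + |C| / (2 * δ) * (w t * ‖1 - Q t‖ ^ 2)
        rw [h7, le_div_iff₀ (by positivity)]
        nlinarith [sq_nonneg (m t * ‖1 - Q t‖ - δ)]
    rw [integral_add (integrable_const _) (hI1.const_mul _), integral_const_mul, integral_const,
      hν, measureReal_restrict_apply_univ, Real.volume_real_Ioo_of_le zero_le_one, ← hν] at hle
    have h8 : δ ≤ δ / 2 + |C| / (2 * δ) * ε ^ 2 := by
      have := mul_le_mul_of_nonneg_left hnorm (show 0 ≤ |C| / (2 * δ) by positivity)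
      have h9 := h1.trans hle
      rw [sub_zero, one_smul] at h9
      linarith
    have h10 : δ / 2 ≤ |C| * ε ^ 2 / (2 * δ) := by
      have : |C| / (2 * δ) * ε ^ 2 = |C| * ε ^ 2 / (2 * δ) := by ring
      linarith
    rw [le_div_iff₀ (by positivity)] at h10
    nlinarith
  -- For this `ε` one has `|C| ε² < δ²`.
  have h1 := key (δ / (2 * (|C| + 1))) (by positivity)
  have hC0 := abs_nonneg C
  rw [div_pow, ← mul_div_assoc, le_div_iff₀ (by positivity)] at h1
  nlinarith [mul_pos hδ hδ, mul_nonneg hC0 hC0, mul_nonneg (mul_pos hδ hδ).le hC0,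
    mul_nonneg (mul_pos hδ hδ).le (mul_nonneg hC0 hC0)]

/-! ### Assembly. -/

theorem theorem5 :
    ∃ C : ℝ, 0 < C ∧
      ∀ Γ : Set ℕ, (∀ γ ∈ Γ, 1 ≤ γ) → RegularlyDistributed C Γ →
        ∃ w : ℝ → ℝ, DeepZeroWeight w ∧ ¬ IsCompleteFamily (remainingFrequencies Γ) w := by
  refine ⟨1 / 100, by norm_num, fun Γ hΓ hreg => ?_⟩
  obtain ⟨G, hGΓ, hsum, r, hr, hcount⟩ := hreg
  have hG : 0 ∉ G := fun h => absurd (hΓ 0 (hGΓ h)) (by norm_num)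
  obtain ⟨K, hK, hlog, hsqrt⟩ := exists_countBelow_bounds hG hr hcount
  have hdeep := deepZeroWeight_deepWeight hG hsum
  refine ⟨deepWeight G, hdeep, ?_⟩
  -- The shift to `N + 1` makes `y = S = 1` admissible for every index, which gives the uniform
  -- bound on the sequence.
  choose f hf horth hint hbound using
    fun N : ℕ => exists_expSum_sequence hG hK hlog hsqrt (N + 1)
  set A := 1000 * Real.exp (3 * K + 1) with hA
  have hA0 : 0 ≤ A := by positivity
  obtain ⟨B, hB⟩ := hdeep.bounded
  have hmeas := measurable_countInv G
  refine not_isCompleteFamily_of_sequence (measurable_deepWeight G) hdeep.pos hB hf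
    (δ := 1 / 6) (L := A * Real.exp (2 * Real.pi))
    (m := fun t => A * Real.exp (2 * Real.pi) * Real.exp (-(countInv G t / 10)))
    (by norm_num) ?_ (fun N => ?_) (fun N t ht => ?_) (by fun_prop) (fun t => by positivity)
    (fun t => ?_) ⟨(A * Real.exp (2 * Real.pi)) ^ 2, fun t ht => ?_⟩ fun t ht => ?_
  · rintro a ⟨n, ⟨hn1, hnΓ⟩, rfl⟩ N
    exact horth N n hn1 fun h => hnΓ (hGΓ h)
  · rw [hint N]; norm_num
  · have h1 : (1 : ℝ) ≤ (N + 1 : ℕ) := by push_cast; linarith [Nat.cast_nonneg (α := ℝ) N]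
    refine (hbound N 1 1 t le_rfl h1 one_pos h1 ht.1).trans ?_
    have h2 : max (Real.exp (-(1 / (5 * √1)))) (Real.exp (-(countBelow G 1 / 5 : ℝ))) ≤ 1 := by
      refine max_le (Real.exp_le_one_iff.2 ?_) (Real.exp_le_one_iff.2 ?_)
      · norm_num
      · have : (0 : ℝ) ≤ countBelow G 1 := Nat.cast_nonneg _
        linarith
    have h3 : Real.exp (2 * Real.pi * 1 * t) ≤ Real.exp (2 * Real.pi) := by
      refine Real.exp_le_exp.2 ?_
      nlinarith [Real.pi_pos, ht.2]
    exact mul_le_mul (mul_le_of_le_one_right hA0 h2) h3 (Real.exp_pos _).le hA0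
  · refine mul_le_of_le_one_right (by positivity) (Real.exp_le_one_iff.2 ?_)
    linarith [countInv_nonneg G t]
  · rw [mul_pow]
    exact mul_le_mul_of_nonneg_left (sq_exp_countInv_le_deepWeight ht.1) (by positivity)
  · have hcast : Tendsto (fun N : ℕ => ((N + 1 : ℕ) : ℝ)) atTop atTop :=
      tendsto_natCast_atTop_atTop.comp (tendsto_add_atTop_nat 1)
    filter_upwards [hcast.eventually_ge_atTop (1 + countInv G t / (20 * Real.pi * t)),
      hcast.eventually_ge_atTop (1 / (20 * Real.pi * t) ^ 2)] with N h1 h2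
    exact norm_le_of_parameters hA0 (hbound N) ht h1 h2
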